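/- For $0<H\le 1$ let $B^H=\{B^H_t\}_{t\ge 0}$ be a fractional Brownian motion with Hurst index $H$, that is, a centred Gaussian process with almost surely continuous paths and covariance $\frac12\left(t^{2H}+s^{2H}-|t-s|^{2H}\right)$ (for $H=1$ this means $B^1_t=t\xi$ with $\xi$ standard normal), and let $X^H_t=\int_0^t e^s\,dB^H_s$, a pathwise Riemann–Stieltjes integral. Let $X^0$ be a centred Gaussian process with $\mathsf E X^0_tX^0_s=0$ if $t\wedge s=0$, $\mathsf E X^0_tX^0_s=\frac12$ if $t,s>0$, $t\ne s$, and $\mathsf E (X^0_t)^2=\frac12(1+e^{2t})$ if $t>0$. Put $\mathsf V(H,t)=\mathsf E(X^H_t)^2$ for $H\in[0,1]$, and for $t>0$ let $\mathsf h(H,t)=-\int_{\mathbb R} p\log p$ be the Shannon entropy of $X^H_t$, where $p$ is the density of $X^H_t$. These quantities are well defined for $H\in[0,1]$ and $t>0$. There are two numbers $1<\tau_1<\log 3<\tau_{1/2}$, not depending on the choice of the processes, such that for $t>0$ the (left) derivative $\frac{\partial \mathsf V}{\partial H}(1,t)$ exists and is negative, zero or positive according to whether $t<\tau_1$, $t=\tau_1$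 or $t>\tau_1$; the derivative $\frac{\partial \mathsf V}{\partial H}(\frac12,t)$ exists and is negative, zero or positive according to whether $t<\tau_{1/2}$, $t=\tau_{1/2}$ or $t>\tau_{1/2}$; and the following holds. (i) If $0<t\le\tau_1$, then $\mathsf V(\cdot,t)$ and $\mathsf h(\cdot,t)$ are strictly decreasing on $[0,1]$. (ii) If $\tau_1<t<\tau_{1/2}$, then there is $H_t\in(\frac12,1)$ such that both $\mathsf V(\cdot,t)$ and $\mathsf h(\cdot,t)$ are strictly decreasing on $[0,H_t]$ and strictly increasing on $[H_t,1]$. If $t=\tau_{1/2}$, the same holds with $H_t=\frac12$. (iii) If $t>\tau_{1/2}$, then there is $\widehat H_t\in(0,\frac12)$ such that both $\mathsf V(\cdot,t)$ and $\mathsf h(\cdot,t)$ are strictly decreasing on $[0,\widehat H_t]$ and strictly increasing on $[\widehat H_t,1]$. -/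

import Mathlib

open MeasureTheory ProbabilityTheory Set
open scoped NNReal

/-- `HasRSIntegral f g t I`: the Riemann–Stieltjes integral of `f` against `g` over `[0, t]` exists
and equals `I`, i.e. the Riemann sums `∑ f (c i) * (g (x (i + 1)) - g (x i))` over tagged partitions
`0 = x 0 ≤ c 0 ≤ x 1 ≤ ⋯ ≤ c (n - 1) ≤ x n = t` converge to `I` as the mesh tends to zero. -/
def HasRSIntegral (f g : ℝ≥0 → ℝ) (t : ℝ≥0) (I : ℝ) : Prop :=
  ∀ ε : ℝ, 0 < ε → ∃ δ : ℝ≥0, 0 < δ ∧ ∀ (n : ℕ) (x c : ℕ → ℝ≥0),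
    x 0 = 0 → x n = t →
    (∀ i < n, x i ≤ c i ∧ c i ≤ x (i + 1) ∧ x (i + 1) ≤ x i + δ) →
    |(∑ i ∈ Finset.range n, f (c i) * (g (x (i + 1)) - g (x i))) - I| < ε

/-- Fractional Brownian motion with Hurst index `H`, as a centred Gaussian process on `[0, ∞)` with
covariance `(t ^ (2 H) + s ^ (2 H) - |t - s| ^ (2 H)) / 2` and a.s. continuous trajectories.
It is used for `0 < H ≤ 1`; for `H = 1` the covariance is `t * s`, so that `B t = t * ξ` with `ξ`
standard normal. -/
structure IsFractionalBM {Ω : Type*} [MeasurableSpace Ω] (H : ℝ) (B : ℝ≥0 → Ω → ℝ)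
    (P : Measure Ω) : Prop where
  gaussian : IsGaussianProcess B P
  mean_zero : ∀ t, ∫ ω, B t ω ∂P = 0
  covariance : ∀ t s : ℝ≥0, ∫ ω, B t ω * B s ω ∂P =
    ((t : ℝ) ^ (2 * H) + (s : ℝ) ^ (2 * H) - |(t : ℝ) - s| ^ (2 * H)) / 2
  continuous_paths : ∀ᵐ ω ∂P, Continuous fun t => B t ω

/-- For `0 < H ≤ 1`: `X t = ∫₀ᵗ eˢ dB s` almost surely, for each `t ≥ 0`, where `B` is a
fractional Brownian motion with Hurst index `H` and the integral is the pathwise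
Riemann–Stieltjes integral. -/
def IsExpWienerIntegral {Ω : Type*} [MeasurableSpace Ω] (H : ℝ) (X : ℝ≥0 → Ω → ℝ)
    (P : Measure Ω) : Prop :=
  ∃ B : ℝ≥0 → Ω → ℝ, IsFractionalBM H B P ∧
    ∀ t, ∀ᵐ ω ∂P, HasRSIntegral (fun s => Real.exp s) (fun s => B s ω) t (X t ω)

/-- The covariance function of the extension of the process to `H = 0`. -/
noncomputable def covZero (t s : ℝ≥0) : ℝ :=
  if min t s = 0 then 0 else if t = s then (1 + Real.exp (2 * t)) / 2 else 1 / 2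

/-- The extension of the process to `H = 0`: a centred Gaussian process with covariance
`covZero`. -/
structure IsEWIFGZero {Ω : Type*} [MeasurableSpace Ω] (X : ℝ≥0 → Ω → ℝ) (P : Measure Ω) :
    Prop where
  gaussian : IsGaussianProcess X P
  mean_zero : ∀ t, ∫ ω, X t ω ∂P = 0
  covariance : ∀ t s, ∫ ω, X t ω * X s ω ∂P = covZero t s

/-- The exponent-Wiener-integral fractional Gaussian process with Hurst index `H ∈ [0, 1]`. -/
def IsEWIFG {Ω : Type*} [MeasurableSpace Ω] (H : ℝ) (X : ℝ≥0 → Ω → ℝ) (P : Measure Ω) : Prop :=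
  (H = 0 ∧ IsEWIFGZero X P) ∨ (0 < H ∧ H ≤ 1 ∧ IsExpWienerIntegral H X P)

/-- `E Y ^ 2`, the variance of the centred random variable `Y`. -/
noncomputable def meanSquare {Ω : Type*} [MeasurableSpace Ω] (P : Measure Ω) (Y : Ω → ℝ) : ℝ :=
  ∫ ω, Y ω ^ 2 ∂P

/-- The density, with respect to Lebesgue measure, of the distribution of `Y`. -/
noncomputable def lawDensity {Ω : Type*} [MeasurableSpace Ω] (P : Measure Ω) (Y : Ω → ℝ)
    (x : ℝ) : ℝ :=
  ((P.map Y).rnDeriv volume x).toReal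

/-- Shannon (differential) entropy `-∫ p log p` of the distribution of `Y`, `p` its density. -/
noncomputable def shannonEntropy {Ω : Type*} [MeasurableSpace Ω] (P : Measure Ω) (Y : Ω → ℝ) : ℝ :=
  ∫ x, Real.negMulLog (lawDensity P Y x)

/-- The Shannon entropy of `Y` is well defined: `Y` has a density `p` and `p log p` is
integrable. -/
def HasShannonEntropy {Ω : Type*} [MeasurableSpace Ω] (P : Measure Ω) (Y : Ω → ℝ) : Prop :=
  AEMeasurable Y P ∧ P.map Y ≪ volume ∧
    Integrable (fun x => Real.negMulLog (lawDensity P Y x)) volume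

/-- On `[0, 1]`, `f` strictly decreases up to `a` and strictly increases from `a` on. -/
def DecreasesThenIncreases (f : ℝ → ℝ) (a : ℝ) : Prop :=
  StrictAntiOn f (Icc 0 a) ∧ StrictMonoOn f (Icc a 1)

/-!
Everything reduces to the closed form of the second moment,
`V(H, t) = eᵗ (t²ᴴ + ∫₀ᵗ s²ᴴ sinh (t - s) ds)`, valid for all `H ∈ [0, 1]` (`expVariance`).

*Law of the process.* For `H > 0`, a fractional Brownian motion is a curve `β` in `L²` with
`‖β s - β u‖ = |s - u| ^ H`. Riemann sums with weights `exp` therefore converge in `L²`, by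
summation by parts, to `eᵗ β t - ∫₀ᵗ eˢ β s ds`, whose squared norm is `V(H, t)`
(`norm_expWiener_sq`). The same sums converge almost surely to `X t`, so by convergence of
characteristic functions `X t` is centred Gaussian with variance `V(H, t)`
(`IsExpWienerIntegral.map_eq`). Its entropy is `log (2 π V) / 2 + 1 / 2`, an increasing function
of `V`, so that entropy and variance have the same shape.

*Shape in `H`.* The derivative is `∂V/∂H = 2 eᵗ G(2H, t)`, where `G(a, t)` is the transform of
`f s = sᵃ log s` under `f ↦ f t + ∫₀ᵗ f s sinh (t - s) ds`. Since `sᵃ log s` increases with `a`,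
`V(·, t)` is strictly convex, and its shape is decided by the signs of the slopes at `1 / 2` and at
`1`, together with `V(1 / 2, t) = eᵗ sinh t < eᵗ cosh t = V(0, t)`, which excludes that `V(·, t)`
increases on all of `[0, 1 / 2]`.

*Signs in `t`.* For `a ≥ 1`, `G(a, t)` is negative for `t ≤ 1`, and `G(a, t) / cosh (t - 1)` is
strictly increasing for `t ≥ 1` (`strictMonoOn_sinhTransform_div_cosh`), so `G(a, ·)` changes sign
at most once. It does so: `G(1, e) > 0` follows from `s log s ≥ s - 1`, and at `t = log 3` one has
`V(1 / 2, t) = V(1, t)`, so that convexity gives `G(1, log 3) < 0 < G(2, log 3)`, which also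
separates the two critical times (`exists_critical_times`).
-/

/-! ### Dependence of the variance on the Hurst index -/

/-- The convolution of `f` on `[0, t]` with the measure `δ₀ + sinh`. -/
noncomputable def sinhTransform (f : ℝ → ℝ) (t : ℝ) : ℝ :=
  f t + ∫ s in (0 : ℝ)..t, f s * Real.sinh (t - s)

/-- At `s = 0` this relies on the conventions `0 ^ a = 0` for `a > 0` and `log 0 = 0`. -/
lemma continuousOn_rpow_mul_log {a : ℝ} (ha : 0 < a) :
    ContinuousOn (fun s : ℝ => s ^ a * Real.log s) (Ici 0) := by
  have h : Continuous fun s : ℝ => a⁻¹ * (s ^ a * Real.log (s ^ a)) :=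
    continuous_const.mul
      (Real.continuous_mul_log.comp (Real.continuous_rpow_const ha.le))
  refine h.continuousOn.congr fun s hs => ?_
  rcases eq_or_lt_of_le (show (0 : ℝ) ≤ s from hs) with rfl | hs
  · simp [Real.zero_rpow ha.ne']
  · simp only [Real.log_rpow hs]
    field_simp

lemma abs_rpow_mul_log_le {a b c s : ℝ} (hac : a ≤ c) (hcb : c ≤ b) (hs : 0 < s) :
    s ^ c * |Real.log s| ≤ (s ^ a + s ^ b) * |Real.log s| := by
  gcongr
  rcases le_total s 1 with h | h
  · exact (Real.rpow_le_rpow_of_exponent_ge hs h hac).trans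
      (le_add_of_nonneg_right (Real.rpow_nonneg hs.le _))
  · exact (Real.rpow_le_rpow_of_exponent_le h hcb).trans
      (le_add_of_nonneg_left (Real.rpow_nonneg hs.le _))

lemma hasDerivAt_rpow_two_mul {s : ℝ} (hs : 0 < s) (H : ℝ) :
    HasDerivAt (fun h : ℝ => s ^ (2 * h)) (2 * (s ^ (2 * H) * Real.log s)) H := by
  have h := ((hasDerivAt_id H).const_mul 2).const_rpow hs
  refine h.congr_deriv ?_
  simp only [id]
  ring

/-- Differentiation of the transform of `s ^ (2 H)` with respect to the exponent. -/
lemma hasDerivAt_sinhTransform_rpow {H t : ℝ} (hH : 0 < H) (ht : 0 < t) :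
    HasDerivAt (fun h : ℝ => sinhTransform (fun s => s ^ (2 * h)) t)
      (2 * sinhTransform (fun s => s ^ (2 * H) * Real.log s) t) H := by
  have hsinh : Continuous fun s : ℝ => Real.sinh (t - s) := by fun_prop
  have hnhds : Ioo (H / 2) (2 * H) ∈ nhds H := Ioo_mem_nhds (by linarith) (by linarith)
  have key := (intervalIntegral.hasDerivAt_integral_of_dominated_loc_of_deriv_le
    (μ := volume) (a := 0) (b := t) (s := Ioo (H / 2) (2 * H)) (x₀ := H)
    (F := fun h s => s ^ (2 * h) * Real.sinh (t - s))
    (F' := fun h s => 2 * (s ^ (2 * h) * Real.log s) * Real.sinh (t - s))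
    (bound := fun s =>
      2 * ((s ^ H + s ^ (4 * H)) * |Real.log s|) * |Real.sinh (t - s)|)
    hnhds ?_ ?_ ?_ ?_ ?_ ?_).2
  · refine ((hasDerivAt_rpow_two_mul ht H).add key).congr_deriv ?_
    rw [sinhTransform, mul_add, ← intervalIntegral.integral_const_mul]
    simp only [mul_assoc]
  · filter_upwards [hnhds] with h hh
    exact ((Real.continuous_rpow_const (by linarith [hh.1] : (0 : ℝ) ≤ 2 * h)).mul
      hsinh).aestronglyMeasurable
  · exact ((Real.continuous_rpow_const (by linarith : (0 : ℝ) ≤ 2 * H)).mul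
      hsinh).intervalIntegrable _ _
  · have : Measurable fun s : ℝ => 2 * (s ^ (2 * H) * Real.log s) * Real.sinh (t - s) := by
      fun_prop
    exact this.aestronglyMeasurable
  · refine Filter.Eventually.of_forall fun s hs h hh => ?_
    rw [uIoc_of_le ht.le] at hs
    rw [Real.norm_eq_abs, abs_mul, abs_mul, abs_mul, abs_of_pos (two_pos : (0 : ℝ) < 2),
      abs_of_nonneg (Real.rpow_nonneg hs.1.le _)]
    exact mul_le_mul_of_nonneg_right (mul_le_mul_of_nonneg_left
      (abs_rpow_mul_log_le (by linarith [hh.1]) (by linarith [hh.2]) hs.1) two_pos.le)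
      (abs_nonneg _)
  · apply ContinuousOn.intervalIntegrable
    rw [uIcc_of_le ht.le]
    refine ContinuousOn.mul (continuousOn_const.mul ?_) hsinh.abs.continuousOn
    have h1 := (continuousOn_rpow_mul_log hH).abs.mono (Icc_subset_Ici_self : Icc 0 t ⊆ _)
    have h2 := (continuousOn_rpow_mul_log (by linarith : 0 < 4 * H)).abs.mono
      (Icc_subset_Ici_self : Icc 0 t ⊆ _)
    refine (h1.add h2).congr fun s hs => ?_
    simp only [Pi.add_apply, abs_mul, abs_of_nonneg (Real.rpow_nonneg hs.1 _), add_mul]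
  · refine Filter.Eventually.of_forall fun s hs h hh => ?_
    rw [uIoc_of_le ht.le] at hs
    exact (hasDerivAt_rpow_two_mul hs.1 h).mul_const _

lemma continuousOn_sinhTransform_rpow {t : ℝ} (ht : 0 < t) :
    ContinuousOn (fun h : ℝ => sinhTransform (fun s => s ^ (2 * h)) t) (Icc 0 1) := by
  have hsinh : Continuous fun s : ℝ => Real.sinh (t - s) := by fun_prop
  intro H _
  refine ContinuousWithinAt.add
    (hasDerivAt_rpow_two_mul ht H).continuousAt.continuousWithinAt ?_
  refine intervalIntegral.continuousWithinAt_of_dominated_interval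
    (bound := fun s => (1 + s ^ 2) * |Real.sinh (t - s)|) ?_ ?_ ?_ ?_
  · refine Filter.Eventually.of_forall fun h => ?_
    have : Measurable fun s : ℝ => s ^ (2 * h) * Real.sinh (t - s) := by fun_prop
    exact this.aestronglyMeasurable
  · filter_upwards [self_mem_nhdsWithin] with h hh
    refine Filter.Eventually.of_forall fun s hs => ?_
    rw [uIoc_of_le ht.le] at hs
    rw [Real.norm_eq_abs, abs_mul, abs_of_nonneg (Real.rpow_nonneg hs.1.le _)]
    gcongr
    rcases le_total s 1 with h1 | h1
    · exact (Real.rpow_le_one hs.1.le h1 (by linarith [hh.1])).trans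
        (le_add_of_nonneg_right (sq_nonneg s))
    · rw [← Real.rpow_two]
      exact (Real.rpow_le_rpow_of_exponent_le h1 (by linarith [hh.2])).trans
        (le_add_of_nonneg_left zero_le_one)
  · exact Continuous.intervalIntegrable (by fun_prop) _ _
  · refine Filter.Eventually.of_forall fun s hs => ?_
    rw [uIoc_of_le ht.le] at hs
    exact ((hasDerivAt_rpow_two_mul hs.1 H).mul_const _).continuousAt.continuousWithinAt

lemma rpow_mul_log_mono {a b s : ℝ} (hab : a ≤ b) (hs : 0 < s) :
    s ^ a * Real.log s ≤ s ^ b * Real.log s := by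
  rcases le_total s 1 with h | h
  · exact mul_le_mul_of_nonpos_right (Real.rpow_le_rpow_of_exponent_ge hs h hab)
      (Real.log_nonpos hs.le h)
  · exact mul_le_mul_of_nonneg_right (Real.rpow_le_rpow_of_exponent_le h hab)
      (Real.log_nonneg h)

/-- Strict convexity of the variance in the exponent: `s ^ a * log s` increases with `a`, strictly
unless `s = 1`. -/
lemma strictMonoOn_sinhTransform_rpow_mul_log {t : ℝ} (ht : 0 < t) :
    StrictMonoOn (fun a : ℝ => sinhTransform (fun s => s ^ a * Real.log s) t) (Ioi 0) := by
  intro a ha b hb hab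
  have hsinh : Continuous fun s : ℝ => Real.sinh (t - s) := by fun_prop
  refine add_lt_add_of_le_of_lt (rpow_mul_log_mono hab.le ht) ?_
  refine intervalIntegral.integral_lt_integral_of_continuousOn_of_le_of_exists_lt ht
    (((continuousOn_rpow_mul_log ha).mono Icc_subset_Ici_self).mul hsinh.continuousOn)
    (((continuousOn_rpow_mul_log hb).mono Icc_subset_Ici_self).mul hsinh.continuousOn)
    (fun s hs => mul_le_mul_of_nonneg_right (rpow_mul_log_mono hab.le hs.1)
      (Real.sinh_nonneg_iff.2 (by linarith [hs.2]))) ?_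
  obtain ⟨c, hc0, hc⟩ := exists_between (lt_min ht one_pos)
  have hct := hc.trans_le (min_le_left _ _)
  have hc1 := hc.trans_le (min_le_right _ _)
  refine ⟨c, ⟨hc0.le, hct.le⟩, mul_lt_mul_of_pos_right ?_ (Real.sinh_pos_iff.2 (by linarith))⟩
  exact mul_lt_mul_of_neg_right (Real.rpow_lt_rpow_of_exponent_gt hc0 hc1 hab)
    (Real.log_neg hc0 hc1)

lemma sinhTransform_rpow_pos (a : ℝ) {t : ℝ} (ht : 0 < t) :
    0 < sinhTransform (fun s => s ^ a) t := by
  refine add_pos_of_pos_of_nonneg (Real.rpow_pos_of_pos ht a) ?_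
  refine intervalIntegral.integral_nonneg ht.le fun s hs => ?_
  exact mul_nonneg (Real.rpow_nonneg hs.1 _) (Real.sinh_nonneg_iff.2 (by linarith [hs.2]))

lemma hasDerivAt_sinh_sub (t s : ℝ) :
    HasDerivAt (fun s => Real.sinh (t - s)) (-Real.cosh (t - s)) s := by
  simpa using ((hasDerivAt_id s).const_sub t).sinh

lemma hasDerivAt_cosh_sub (t s : ℝ) :
    HasDerivAt (fun s => Real.cosh (t - s)) (-Real.sinh (t - s)) s := by
  simpa using ((hasDerivAt_id s).const_sub t).cosh

lemma integral_sinh_sub (t : ℝ) :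
    ∫ s in (0 : ℝ)..t, Real.sinh (t - s) = Real.cosh t - 1 := by
  rw [intervalIntegral.integral_eq_sub_of_hasDerivAt (f := fun s => -Real.cosh (t - s))]
  · simp; ring
  · intro s _; simpa using (hasDerivAt_cosh_sub t s).fun_neg
  · exact Continuous.intervalIntegrable (by fun_prop) _ _

lemma integral_mul_sinh_sub (t : ℝ) :
    ∫ s in (0 : ℝ)..t, s * Real.sinh (t - s) = Real.sinh t - t := by
  rw [intervalIntegral.integral_eq_sub_of_hasDerivAt
    (f := fun s => -(s * Real.cosh (t - s)) - Real.sinh (t - s))]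
  · simp; ring
  · intro s _
    refine (((hasDerivAt_id s).mul (hasDerivAt_cosh_sub t s)).neg.sub
      (hasDerivAt_sinh_sub t s)).congr_deriv ?_
    simp
  · exact Continuous.intervalIntegrable (by fun_prop) _ _

lemma integral_sq_mul_sinh_sub (t : ℝ) :
    ∫ s in (0 : ℝ)..t, s ^ 2 * Real.sinh (t - s) = 2 * Real.cosh t - 2 - t ^ 2 := by
  rw [intervalIntegral.integral_eq_sub_of_hasDerivAt
    (f := fun s => -(s ^ 2 * Real.cosh (t - s)) - 2 * (s * Real.sinh (t - s))
      - 2 * Real.cosh (t - s))]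
  · simp; ring
  · intro s _
    refine (((((hasDerivAt_id s).pow 2).mul (hasDerivAt_cosh_sub t s)).neg.sub
      (((hasDerivAt_id s).mul (hasDerivAt_sinh_sub t s)).const_mul 2)).sub
      ((hasDerivAt_cosh_sub t s).const_mul 2)).congr_deriv ?_
    simp; ring
  · exact Continuous.intervalIntegrable (by fun_prop) _ _

lemma sinhTransform_rpow_zero (t : ℝ) :
    sinhTransform (fun s => s ^ (2 * (0 : ℝ))) t = Real.cosh t := by
  simp only [sinhTransform, mul_zero, Real.rpow_zero, one_mul, integral_sinh_sub]
  ring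

lemma sinhTransform_rpow_half (t : ℝ) :
    sinhTransform (fun s => s ^ (2 * (1 / 2 : ℝ))) t = Real.sinh t := by
  simp [sinhTransform, integral_mul_sinh_sub]

lemma sinhTransform_rpow_one (t : ℝ) :
    sinhTransform (fun s => s ^ (2 * (1 : ℝ))) t = 2 * Real.cosh t - 2 := by
  simp only [sinhTransform, mul_one, Real.rpow_two, integral_sq_mul_sinh_sub]
  ring

/-! ### Dependence of the slope on time -/

lemma sinhTransform_rpow_mul_log_neg {a t : ℝ} (ha : 0 < a) (ht : 0 < t) (ht1 : t ≤ 1) :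
    sinhTransform (fun s => s ^ a * Real.log s) t < 0 := by
  have hsinh : Continuous fun s : ℝ => Real.sinh (t - s) := by fun_prop
  refine add_neg_of_nonpos_of_neg (mul_nonpos_of_nonneg_of_nonpos
    (Real.rpow_nonneg ht.le _) (Real.log_nonpos ht.le ht1)) ?_
  have h := intervalIntegral.integral_lt_integral_of_continuousOn_of_le_of_exists_lt
    (f := fun s => s ^ a * Real.log s * Real.sinh (t - s)) (g := fun _ => 0) ht
    (((continuousOn_rpow_mul_log ha).mono Icc_subset_Ici_self).mul hsinh.continuousOn)
    continuousOn_const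
    (fun s hs => mul_nonpos_of_nonpos_of_nonneg (mul_nonpos_of_nonneg_of_nonpos
      (Real.rpow_nonneg hs.1.le _) (Real.log_nonpos hs.1.le (hs.2.trans ht1)))
      (Real.sinh_nonneg_iff.2 (by linarith [hs.2])))
    ⟨t / 2, ⟨by linarith, by linarith⟩, mul_neg_of_neg_of_pos (mul_neg_of_pos_of_neg
      (Real.rpow_pos_of_pos (by linarith) _) (Real.log_neg (by linarith) (by linarith)))
      (Real.sinh_pos_iff.2 (by linarith))⟩
  simpa using h

lemma hasDerivAt_integral_of_continuousOn_Ici {f : ℝ → ℝ} (hf : ContinuousOn f (Ici 0)) {t : ℝ}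
    (ht : 0 < t) : HasDerivAt (fun u => ∫ s in (0 : ℝ)..u, f s) (f t) t := by
  refine intervalIntegral.integral_hasDerivAt_right ?_ ?_ (hf.continuousAt (Ici_mem_nhds ht))
  · refine ContinuousOn.intervalIntegrable (hf.mono ?_)
    rw [uIcc_of_le ht.le]
    exact Icc_subset_Ici_self
  · exact (hf.mono Ioi_subset_Ici_self).stronglyMeasurableAtFilter isOpen_Ioi t ht

/-- The addition theorem for `sinh`, centred at `1`, where the logarithm changes sign. -/
lemma sinhTransform_eq_centred {f : ℝ → ℝ} (hf : ContinuousOn f (Ici 0)) {t : ℝ} (ht : 0 ≤ t) :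
    sinhTransform f t = f t + Real.sinh (t - 1) * (∫ s in (0 : ℝ)..t, f s * Real.cosh (s - 1))
      - Real.cosh (t - 1) * ∫ s in (0 : ℝ)..t, f s * Real.sinh (s - 1) := by
  have hf' : ContinuousOn f (uIcc 0 t) := by
    rw [uIcc_of_le ht]
    exact hf.mono Icc_subset_Ici_self
  rw [sinhTransform, add_sub_assoc, ← intervalIntegral.integral_const_mul,
    ← intervalIntegral.integral_const_mul, ← intervalIntegral.integral_sub]
  · congr 1
    refine intervalIntegral.integral_congr fun s _ => ?_
    rw [show t - s = (t - 1) - (s - 1) by ring, Real.sinh_sub]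
    ring
  · exact (continuousOn_const.mul (hf'.mul (by fun_prop))).intervalIntegrable
  · exact (continuousOn_const.mul (hf'.mul (by fun_prop))).intervalIntegrable

lemma sub_one_le_rpow_mul_log {a s : ℝ} (ha : 1 ≤ a) (hs : 0 ≤ s) :
    s - 1 ≤ s ^ a * Real.log s := by
  rcases eq_or_lt_of_le hs with rfl | hs
  · simp
  · refine le_trans ?_ (rpow_mul_log_mono ha hs)
    have h := mul_le_mul_of_nonneg_left (Real.one_sub_inv_le_log_of_pos hs) hs.le
    rw [mul_sub, mul_one, mul_inv_cancel₀ hs.ne'] at h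
    rwa [Real.rpow_one]

lemma integral_sub_one_mul_cosh :
    ∫ s in (0 : ℝ)..1, (s - 1) * Real.cosh (s - 1) = Real.exp (-1) - 1 := by
  rw [intervalIntegral.integral_eq_sub_of_hasDerivAt
    (f := fun s => (s - 1) * Real.sinh (s - 1) - Real.cosh (s - 1))]
  · rw [← Real.cosh_sub_sinh 1]
    simp
    ring
  · intro s _
    have h := (hasDerivAt_id s).sub_const 1
    refine ((h.mul h.sinh).sub h.cosh).congr_deriv ?_
    simp
  · exact Continuous.intervalIntegrable (by fun_prop) _ _

lemma hasDerivAt_rpow_mul_log (a : ℝ) {t : ℝ} (ht : 0 < t) :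
    HasDerivAt (fun s : ℝ => s ^ a * Real.log s)
      (t ^ (a - 1) * (a * Real.log t + 1)) t := by
  refine ((Real.hasDerivAt_rpow_const (Or.inl ht.ne')).mul
    (Real.hasDerivAt_log ht.ne')).congr_deriv ?_
  rw [Real.rpow_sub_one ht.ne']
  field_simp

/-- The numerator in the derivative of the transform of `s ^ a * log s` divided by
`cosh (t - 1)`. -/
noncomputable def logWronskian (a t : ℝ) : ℝ :=
  t ^ (a - 1) * (a * Real.log t + 1) * Real.cosh (t - 1)
    - t ^ a * Real.log t * Real.sinh (t - 1)
    + ∫ s in (0 : ℝ)..t, s ^ a * Real.log s * Real.cosh (s - 1)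

lemma continuousOn_rpow_mul_log_mul_cosh {a : ℝ} (ha : 0 < a) :
    ContinuousOn (fun s : ℝ => s ^ a * Real.log s * Real.cosh (s - 1)) (Ici 0) :=
  (continuousOn_rpow_mul_log ha).mul (by fun_prop)

lemma logWronskian_one_pos {a : ℝ} (ha : 1 ≤ a) : 0 < logWronskian a 1 := by
  -- The bound `s - 1` has integral `e⁻¹ - 1 > -1`, while the boundary term at `t = 1` equals `1`.
  have h : ∫ s in (0 : ℝ)..1, (s - 1) * Real.cosh (s - 1) ≤
      ∫ s in (0 : ℝ)..1, s ^ a * Real.log s * Real.cosh (s - 1) := by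
    refine intervalIntegral.integral_mono_on zero_le_one
      (Continuous.intervalIntegrable (by fun_prop) _ _) ?_ fun s hs =>
      mul_le_mul_of_nonneg_right (sub_one_le_rpow_mul_log ha hs.1) (Real.cosh_pos _).le
    refine ContinuousOn.intervalIntegrable
      ((continuousOn_rpow_mul_log_mul_cosh (by linarith)).mono ?_)
    rw [uIcc_of_le zero_le_one]
    exact Icc_subset_Ici_self
  rw [integral_sub_one_mul_cosh] at h
  have := Real.exp_pos (-1)
  simp only [logWronskian, Real.one_rpow, Real.log_one, sub_self, Real.cosh_zero, Real.sinh_zero]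
  linarith

/-- The derivative is `f'' t * cosh (t - 1)` for `f s = s ^ a * log s`; it is nonnegative for
`t ≥ 1`. -/
lemma hasDerivAt_logWronskian {a t : ℝ} (ha : 1 ≤ a) (ht : 0 < t) :
    HasDerivAt (logWronskian a)
      (t ^ (a - 1 - 1) * ((a - 1) * (a * Real.log t + 1) + a) * Real.cosh (t - 1)) t := by
  have h1 := (hasDerivAt_id t).sub_const 1
  have hf1 : HasDerivAt (fun s : ℝ => s ^ (a - 1) * (a * Real.log s + 1))
      (t ^ (a - 1 - 1) * ((a - 1) * (a * Real.log t + 1) + a)) t := by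
    refine ((Real.hasDerivAt_rpow_const (Or.inl ht.ne')).mul
      (((Real.hasDerivAt_log ht.ne').const_mul a).add_const 1)).congr_deriv ?_
    rw [Real.rpow_sub_one ht.ne' (a - 1)]
    field_simp
  refine (((hf1.mul h1.cosh).sub ((hasDerivAt_rpow_mul_log a ht).mul h1.sinh)).add
    (hasDerivAt_integral_of_continuousOn_Ici
      (continuousOn_rpow_mul_log_mul_cosh (by linarith)) ht)).congr_deriv ?_
  simp only [id]
  ring

lemma logWronskian_pos {a t : ℝ} (ha : 1 ≤ a) (ht : 1 ≤ t) : 0 < logWronskian a t := by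
  have hmono : MonotoneOn (logWronskian a) (Ici 1) := by
    refine monotoneOn_of_deriv_nonneg (convex_Ici 1)
      (fun s hs => (hasDerivAt_logWronskian ha (zero_lt_one.trans_le hs)).continuousAt
        |>.continuousWithinAt) ?_ ?_
    · intro s hs
      rw [interior_Ici] at hs
      exact (hasDerivAt_logWronskian ha (zero_lt_one.trans hs)).differentiableAt
        |>.differentiableWithinAt
    · intro s hs
      rw [interior_Ici, mem_Ioi] at hs
      rw [(hasDerivAt_logWronskian ha (zero_lt_one.trans hs)).deriv]
      have := Real.log_nonneg hs.le
      have := Real.cosh_pos (s - 1)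
      have := Real.rpow_nonneg (zero_le_one.trans hs.le) (a - 1 - 1)
      have : 0 ≤ a - 1 := by linarith
      positivity
  exact (logWronskian_one_pos ha).trans_le (hmono self_mem_Ici ht ht)

lemma hasDerivAt_sinhTransform_div_cosh {a t : ℝ} (ha : 1 ≤ a) (ht : 0 < t) :
    HasDerivAt (fun t => sinhTransform (fun s => s ^ a * Real.log s) t / Real.cosh (t - 1))
      (logWronskian a t / Real.cosh (t - 1) ^ 2) t := by
  have hf := continuousOn_rpow_mul_log (by linarith : 0 < a)
  have h1 := (hasDerivAt_id t).sub_const 1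
  have hA := hasDerivAt_integral_of_continuousOn_Ici
    (continuousOn_rpow_mul_log_mul_cosh (by linarith : 0 < a)) ht
  have hB := hasDerivAt_integral_of_continuousOn_Ici
    (hf.mul (by fun_prop : ContinuousOn (fun s : ℝ => Real.sinh (s - 1)) (Ici 0))) ht
  have h := (((hasDerivAt_rpow_mul_log a ht).add (h1.sinh.mul hA)).sub (h1.cosh.mul hB)).div
    h1.cosh (Real.cosh_pos _).ne'
  refine (h.congr_of_eventuallyEq ?_).congr_deriv ?_
  · filter_upwards [Ioi_mem_nhds ht] with u hu
    rw [sinhTransform_eq_centred hf (le_of_lt hu)]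
    rfl
  · congr 1
    simp only [logWronskian, id, Pi.add_apply, Pi.sub_apply, Pi.mul_apply]
    linear_combination (∫ s in (0 : ℝ)..t, s ^ a * Real.log s * Real.cosh (s - 1)) *
      Real.cosh_sq_sub_sinh_sq (t - 1)

lemma strictMonoOn_sinhTransform_div_cosh {a : ℝ} (ha : 1 ≤ a) :
    StrictMonoOn (fun t => sinhTransform (fun s => s ^ a * Real.log s) t / Real.cosh (t - 1))
      (Ici 1) := by
  refine strictMonoOn_of_deriv_pos (convex_Ici 1) (fun s hs =>
    (hasDerivAt_sinhTransform_div_cosh ha (zero_lt_one.trans_le hs)).continuousAt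
      |>.continuousWithinAt) fun s hs => ?_
  rw [interior_Ici, mem_Ioi] at hs
  rw [(hasDerivAt_sinhTransform_div_cosh ha (zero_lt_one.trans hs)).deriv]
  exact div_pos (logWronskian_pos ha hs.le) (pow_pos (Real.cosh_pos _) 2)

/-- Once the transform of `s ^ a * log s` is positive somewhere, it changes sign exactly once. -/
lemma exists_sign_sinhTransform_rpow_mul_log {a b : ℝ} (ha : 1 ≤ a) (hb : 1 ≤ b)
    (hpos : 0 < sinhTransform (fun s => s ^ a * Real.log s) b) :
    ∃ τ, 1 < τ ∧ ∀ t, 0 < t →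
      SignType.sign (sinhTransform (fun s => s ^ a * Real.log s) t) = SignType.sign (t - τ) := by
  set Q := fun t => sinhTransform (fun s => s ^ a * Real.log s) t / Real.cosh (t - 1) with hQ
  have hmono : StrictMonoOn Q (Ici 1) := strictMonoOn_sinhTransform_div_cosh ha
  have hcont : ContinuousOn Q (Icc 1 b) := fun s hs =>
    (hasDerivAt_sinhTransform_div_cosh ha (zero_lt_one.trans_le hs.1)).continuousAt
      |>.continuousWithinAt
  have hneg : ∀ t, 0 < t → t ≤ 1 → Q t < 0 := fun t h0 h1 =>
    div_neg_of_neg_of_pos (sinhTransform_rpow_mul_log_neg (by linarith) h0 h1) (Real.cosh_pos _)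
  obtain ⟨τ, hτ, hτ0⟩ := intermediate_value_Icc hb hcont
    ⟨(hneg 1 one_pos le_rfl).le, (div_pos hpos (Real.cosh_pos _)).le⟩
  have hτ1 : 1 < τ := by
    refine lt_of_le_of_ne hτ.1 fun h => ?_
    rw [← h] at hτ0
    exact (hneg 1 one_pos le_rfl).ne hτ0
  refine ⟨τ, hτ1, fun t ht => ?_⟩
  have hsign : SignType.sign (sinhTransform (fun s => s ^ a * Real.log s) t) =
      SignType.sign (Q t) := by
    simp only [hQ]
    rw [div_eq_mul_inv, sign_mul, sign_pos (inv_pos.2 (Real.cosh_pos _)), mul_one]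
  rw [hsign]
  rcases lt_trichotomy t τ with h | h | h
  · rw [sign_neg (sub_neg.2 h)]
    refine sign_neg ?_
    rcases le_total t 1 with h1 | h1
    · exact hneg t ht h1
    · exact hτ0 ▸ hmono h1 hτ.1 h
  · rw [h, hτ0, sub_self]
  · rw [sign_pos (sub_pos.2 h)]
    exact sign_pos (hτ0 ▸ hmono hτ.1 (hτ1.le.trans h.le) h)

/-- The bound `s - 1 ≤ s * log s` inside the integral costs `1 - e - e^(-e)`, which is less in
absolute value than the boundary term `e * log e = e`. -/
lemma sinhTransform_mul_log_exp_one_pos :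
    0 < sinhTransform (fun s => s ^ (1 : ℝ) * Real.log s) (Real.exp 1) := by
  have he := Real.exp_pos 1
  have h : ∫ s in (0 : ℝ)..Real.exp 1, (s - 1) * Real.sinh (Real.exp 1 - s) ≤
      ∫ s in (0 : ℝ)..Real.exp 1, s ^ (1 : ℝ) * Real.log s * Real.sinh (Real.exp 1 - s) := by
    refine intervalIntegral.integral_mono_on he.le
      (Continuous.intervalIntegrable (by fun_prop) _ _) ?_ fun s hs =>
      mul_le_mul_of_nonneg_right (sub_one_le_rpow_mul_log le_rfl hs.1)
        (Real.sinh_nonneg_iff.2 (by linarith [hs.2]))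
    refine ContinuousOn.intervalIntegrable (ContinuousOn.mul
      ((continuousOn_rpow_mul_log one_pos).mono ?_) (by fun_prop))
    rw [uIcc_of_le he.le]
    exact Icc_subset_Ici_self
  have h2 : ∫ s in (0 : ℝ)..Real.exp 1, (s - 1) * Real.sinh (Real.exp 1 - s) =
      1 - Real.exp 1 - Real.exp (-Real.exp 1) := by
    simp only [sub_mul, one_mul]
    rw [intervalIntegral.integral_sub (Continuous.intervalIntegrable (by fun_prop) _ _)
      (Continuous.intervalIntegrable (by fun_prop) _ _), integral_mul_sinh_sub,
      integral_sinh_sub, ← Real.cosh_sub_sinh]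
    ring
  rw [h2] at h
  have h3 : Real.exp (-Real.exp 1) < 1 := Real.exp_lt_one_iff.2 (by linarith)
  rw [sinhTransform, Real.rpow_one, Real.log_exp]
  linarith

/-! ### Closed form of the variance and its shape in the Hurst index -/

lemma strictAntiOn_of_slope_neg {f D : ℝ → ℝ} {a : ℝ} (hf : ContinuousOn f (Icc 0 a))
    (hD : ∀ x, 0 < x → HasDerivAt f (D x) x) (h : ∀ x ∈ Ioo 0 a, D x < 0) :
    StrictAntiOn f (Icc 0 a) := by
  refine strictAntiOn_of_deriv_neg (convex_Icc 0 a) hf fun x hx => ?_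
  rw [interior_Icc] at hx
  rw [(hD x hx.1).deriv]
  exact h x hx

lemma decreasesThenIncreases_of_slope {f D : ℝ → ℝ} {a : ℝ} (ha : 0 < a) (ha1 : a ≤ 1)
    (hf : ContinuousOn f (Icc 0 1)) (hD : ∀ x, 0 < x → HasDerivAt f (D x) x)
    (hmono : StrictMonoOn D (Ioi 0)) (h0 : D a = 0) : DecreasesThenIncreases f a := by
  constructor
  · exact strictAntiOn_of_slope_neg (hf.mono (Icc_subset_Icc_right ha1)) hD fun x hx =>
      h0 ▸ hmono hx.1 ha hx.2
  · refine strictMonoOn_of_deriv_pos (convex_Icc a 1)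
      (hf.mono (Icc_subset_Icc_left ha.le)) fun x hx => ?_
    rw [interior_Icc] at hx
    rw [(hD x (ha.trans hx.1)).deriv]
    exact h0 ▸ hmono ha (ha.trans hx.1) hx.1

lemma exists_slope_eq_zero {f D : ℝ → ℝ} {x y : ℝ} (hx : 0 < x) (hxy : x ≤ y)
    (hD : ∀ x, 0 < x → HasDerivAt f (D x) x) (hneg : D x < 0) (hpos : 0 < D y) :
    ∃ a ∈ Ioo x y, D a = 0 :=
  exists_hasDerivWithinAt_eq_of_gt_of_lt hxy
    (fun z hz => (hD z (hx.trans_le hz.1)).hasDerivWithinAt) hneg hpos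

/-- The second moment at time `t` of the process with Hurst index `H`, in closed form. -/
noncomputable def expVariance (t H : ℝ) : ℝ :=
  Real.exp t * sinhTransform (fun s => s ^ (2 * H)) t

/-- The derivative of `expVariance t` at `H > 0`. -/
noncomputable def expVarianceSlope (t H : ℝ) : ℝ :=
  Real.exp t * (2 * sinhTransform (fun s => s ^ (2 * H) * Real.log s) t)

lemma expVariance_pos {t : ℝ} (ht : 0 < t) (H : ℝ) : 0 < expVariance t H :=
  mul_pos (Real.exp_pos t) (sinhTransform_rpow_pos _ ht)

lemma continuousOn_expVariance {t : ℝ} (ht : 0 < t) : ContinuousOn (expVariance t) (Icc 0 1) :=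
  continuousOn_const.mul (continuousOn_sinhTransform_rpow ht)

lemma hasDerivAt_expVariance {t : ℝ} (ht : 0 < t) {H : ℝ} (hH : 0 < H) :
    HasDerivAt (expVariance t) (expVarianceSlope t H) H :=
  (hasDerivAt_sinhTransform_rpow hH ht).const_mul _

lemma strictMonoOn_expVarianceSlope {t : ℝ} (ht : 0 < t) :
    StrictMonoOn (expVarianceSlope t) (Ioi 0) := by
  intro a ha b hb hab
  have h := strictMonoOn_sinhTransform_rpow_mul_log ht (mem_Ioi.2 (mul_pos two_pos ha))
    (mem_Ioi.2 (mul_pos two_pos hb)) (mul_lt_mul_of_pos_left hab two_pos)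
  exact mul_lt_mul_of_pos_left (mul_lt_mul_of_pos_left h two_pos) (Real.exp_pos t)

lemma sign_expVarianceSlope (t H : ℝ) : SignType.sign (expVarianceSlope t H) =
    SignType.sign (sinhTransform (fun s => s ^ (2 * H) * Real.log s) t) := by
  rw [expVarianceSlope, sign_mul, sign_mul, sign_pos (Real.exp_pos t), sign_pos two_pos, one_mul,
    one_mul]

lemma expVariance_zero (t : ℝ) : expVariance t 0 = (1 + Real.exp (2 * t)) / 2 := by
  rw [expVariance, sinhTransform_rpow_zero, Real.cosh_eq, two_mul, Real.exp_add, mul_div_assoc',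
    mul_add, ← Real.exp_add t (-t), add_neg_cancel, Real.exp_zero, add_comm]

lemma expVariance_half_lt_zero (t : ℝ) : expVariance t (1 / 2) < expVariance t 0 := by
  rw [expVariance, expVariance, sinhTransform_rpow_half, sinhTransform_rpow_zero]
  exact mul_lt_mul_of_pos_left (Real.sinh_lt_cosh t) (Real.exp_pos t)

lemma expVariance_log_three : expVariance (Real.log 3) (1 / 2) = expVariance (Real.log 3) 1 := by
  rw [expVariance, expVariance, sinhTransform_rpow_half, sinhTransform_rpow_one, Real.sinh_eq,
    Real.cosh_eq, Real.exp_neg, Real.exp_log three_pos]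
  norm_num

/-- At `t = log 3` the variances for `H = 1 / 2` and `H = 1` agree, so by Rolle's theorem and
convexity the slope is negative at the former and positive at the latter. -/
lemma expVarianceSlope_log_three :
    expVarianceSlope (Real.log 3) (1 / 2) < 0 ∧ 0 < expVarianceSlope (Real.log 3) 1 := by
  have ht : 0 < Real.log 3 := Real.log_pos (by norm_num)
  obtain ⟨c, hc, hc0⟩ := exists_hasDerivAt_eq_zero (f := expVariance (Real.log 3))
    (by norm_num : (1 / 2 : ℝ) < 1)
    ((continuousOn_expVariance ht).mono (Icc_subset_Icc_left (by norm_num)))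
    expVariance_log_three fun x hx => hasDerivAt_expVariance ht (by linarith [hx.1])
  have hmono := strictMonoOn_expVarianceSlope ht
  have hcpos : 0 < c := by linarith [hc.1]
  exact ⟨hc0 ▸ hmono (by norm_num : (0 : ℝ) < 1 / 2) hcpos hc.1,
    hc0 ▸ hmono hcpos (mem_Ioi.2 one_pos) hc.2⟩

lemma one_lt_log_three : 1 < Real.log 3 := by
  rw [Real.lt_log_iff_exp_lt three_pos]
  exact Real.exp_one_lt_three

/-- The critical times `τ₁` for `H = 1` and `τh` for `H = 1 / 2`, at which the slope of the variance
changes sign. -/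
lemma exists_critical_times : ∃ τ₁ τh : ℝ, 1 < τ₁ ∧ τ₁ < Real.log 3 ∧ Real.log 3 < τh ∧
    ∀ t, 0 < t → SignType.sign (expVarianceSlope t 1) = SignType.sign (t - τ₁) ∧
      SignType.sign (expVarianceSlope t (1 / 2)) = SignType.sign (t - τh) := by
  obtain ⟨hneg, hpos⟩ := expVarianceSlope_log_three
  have ht : 0 < Real.log 3 := Real.log_pos (by norm_num)
  have h1 : 0 < sinhTransform (fun s => s ^ (2 * (1 : ℝ)) * Real.log s) (Real.log 3) := by
    rwa [← sign_eq_one_iff, ← sign_expVarianceSlope, sign_eq_one_iff]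
  obtain ⟨τ₁, hτ₁, hs₁⟩ := exists_sign_sinhTransform_rpow_mul_log (by norm_num)
    one_lt_log_three.le h1
  obtain ⟨τh, _, hsh⟩ := exists_sign_sinhTransform_rpow_mul_log le_rfl
    (Real.one_le_exp zero_le_one) sinhTransform_mul_log_exp_one_pos
  rw [show (1 : ℝ) = 2 * (1 / 2) by norm_num] at hsh
  simp only [← sign_expVarianceSlope] at hs₁ hsh
  refine ⟨τ₁, τh, hτ₁, ?_, ?_, fun t ht => ⟨hs₁ t ht, hsh t ht⟩⟩
  · have := hs₁ _ ht
    rw [sign_pos hpos, eq_comm, sign_eq_one_iff] at this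
    linarith
  · have := hsh _ ht
    rw [sign_neg hneg, eq_comm, sign_eq_neg_one_iff] at this
    linarith

section Shape

variable {t : ℝ}

lemma strictAntiOn_expVariance (ht : 0 < t) (h1 : expVarianceSlope t 1 ≤ 0) :
    StrictAntiOn (expVariance t) (Icc 0 1) :=
  strictAntiOn_of_slope_neg (continuousOn_expVariance ht) (fun _ => hasDerivAt_expVariance ht)
    fun _ hx => (strictMonoOn_expVarianceSlope ht hx.1 (mem_Ioi.2 one_pos) hx.2).trans_le h1

lemma decreasesThenIncreases_expVariance (ht : 0 < t) {a : ℝ} (ha : 0 < a) (ha1 : a ≤ 1)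
    (h0 : expVarianceSlope t a = 0) : DecreasesThenIncreases (expVariance t) a :=
  decreasesThenIncreases_of_slope ha ha1 (continuousOn_expVariance ht)
    (fun _ => hasDerivAt_expVariance ht) (strictMonoOn_expVarianceSlope ht) h0

lemma exists_decreasesThenIncreases_of_half_neg (ht : 0 < t)
    (hh : expVarianceSlope t (1 / 2) < 0) (h1 : 0 < expVarianceSlope t 1) :
    ∃ a ∈ Ioo (1 / 2 : ℝ) 1, DecreasesThenIncreases (expVariance t) a := by
  obtain ⟨a, ha, h0⟩ := exists_slope_eq_zero (by norm_num) (by norm_num)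
    (fun _ => hasDerivAt_expVariance ht) hh h1
  exact ⟨a, ha, decreasesThenIncreases_expVariance ht (by linarith [ha.1]) ha.2.le h0⟩

/-- The slope is negative somewhere on `(0, 1 / 2)` because the variance for `H = 1 / 2` is always
smaller than for `H = 0`. -/
lemma exists_decreasesThenIncreases_of_half_pos (ht : 0 < t)
    (hh : 0 < expVarianceSlope t (1 / 2)) :
    ∃ a ∈ Ioo (0 : ℝ) (1 / 2), DecreasesThenIncreases (expVariance t) a := by
  obtain ⟨c, hc, hcs⟩ := exists_hasDerivAt_eq_slope (expVariance t) (expVarianceSlope t)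
    (by norm_num : (0 : ℝ) < 1 / 2)
    ((continuousOn_expVariance ht).mono (Icc_subset_Icc_right (by norm_num)))
    fun x hx => hasDerivAt_expVariance ht hx.1
  have hneg : expVarianceSlope t c < 0 := by
    rw [hcs]
    exact div_neg_of_neg_of_pos (by linarith [expVariance_half_lt_zero t]) (by norm_num)
  obtain ⟨a, ha, h0⟩ := exists_slope_eq_zero hc.1 hc.2.le
    (fun _ => hasDerivAt_expVariance ht) hneg hh
  exact ⟨a, ⟨hc.1.trans ha.1, ha.2⟩,
    decreasesThenIncreases_expVariance ht (hc.1.trans ha.1) (by linarith [ha.2]) h0⟩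

end Shape

/-! ### Entropy of a centred Gaussian law -/

lemma negMulLog_gaussianPDFReal {v : ℝ≥0} (hv : v ≠ 0) (x : ℝ) :
    Real.negMulLog (gaussianPDFReal 0 v x) =
      gaussianPDFReal 0 v x * (Real.log (2 * Real.pi * v) / 2 + x ^ 2 / (2 * v)) := by
  have hv0 : (0 : ℝ) < v := NNReal.coe_pos.2 (pos_iff_ne_zero.2 hv)
  have hlog : Real.log (gaussianPDFReal 0 v x) =
      -(Real.log (2 * Real.pi * v) / 2) - x ^ 2 / (2 * v) := by
    rw [gaussianPDFReal, Real.log_mul (by positivity) (Real.exp_pos _).ne', Real.log_exp,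
      Real.log_inv, Real.log_sqrt (by positivity)]
    ring
  rw [Real.negMulLog, hlog]
  ring

lemma lawDensity_ae_eq {Ω : Type*} [MeasurableSpace Ω] {P : Measure Ω} {Y : Ω → ℝ} {v : ℝ≥0}
    (h : P.map Y = gaussianReal 0 v) :
    lawDensity P Y =ᵐ[volume] gaussianPDFReal 0 v := by
  have := rnDeriv_gaussianReal 0 v
  rw [← h] at this
  filter_upwards [this] with x hx
  rw [lawDensity, hx, toReal_gaussianPDF]

lemma integrable_sq_gaussianReal (v : ℝ≥0) : Integrable (fun x => x ^ 2) (gaussianReal 0 v) :=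
  (memLp_id_gaussianReal' (μ := 0) (v := v) 2 (by simp)).integrable_sq

lemma integral_sq_gaussianReal (v : ℝ≥0) : ∫ x, x ^ 2 ∂(gaussianReal 0 v) = v := by
  have h := variance_fun_id_gaussianReal (μ := 0) (v := v)
  rw [variance_of_integral_eq_zero (by fun_prop) integral_id_gaussianReal] at h
  exact h

lemma hasShannonEntropy_of_map_eq {Ω : Type*} [MeasurableSpace Ω] {P : Measure Ω} {Y : Ω → ℝ}
    (hY : AEMeasurable Y P) {v : ℝ≥0} (hv : v ≠ 0) (h : P.map Y = gaussianReal 0 v) :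
    HasShannonEntropy P Y := by
  refine ⟨hY, h ▸ gaussianReal_absolutelyContinuous 0 hv, ?_⟩
  have hint : Integrable (fun x => Real.log (2 * Real.pi * v) / 2 + x ^ 2 / (2 * v))
      (gaussianReal 0 v) :=
    (integrable_const _).add ((integrable_sq_gaussianReal v).div_const _)
  rw [gaussianReal_of_var_ne_zero 0 hv, integrable_withDensity_iff_integrable_smul'
    (measurable_gaussianPDF 0 v) (Filter.Eventually.of_forall fun _ => gaussianPDF_lt_top)] at hint
  refine hint.congr ?_
  filter_upwards [lawDensity_ae_eq h] with x hx
  rw [hx, negMulLog_gaussianPDFReal hv, toReal_gaussianPDF, smul_eq_mul]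

lemma shannonEntropy_of_map_eq {Ω : Type*} [MeasurableSpace Ω] {P : Measure Ω} {Y : Ω → ℝ}
    {v : ℝ≥0} (hv : v ≠ 0) (h : P.map Y = gaussianReal 0 v) :
    shannonEntropy P Y = Real.log (2 * Real.pi * v) / 2 + 1 / 2 := by
  have hv0 : (v : ℝ) ≠ 0 := NNReal.coe_ne_zero.2 hv
  have h1 : shannonEntropy P Y =
      ∫ x, Real.log (2 * Real.pi * v) / 2 + x ^ 2 / (2 * v) ∂(gaussianReal 0 v) := by
    rw [integral_gaussianReal_eq_integral_smul hv, shannonEntropy]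
    refine integral_congr_ae ?_
    filter_upwards [lawDensity_ae_eq h] with x hx
    rw [hx, negMulLog_gaussianPDFReal hv, smul_eq_mul]
  rw [h1, integral_add (integrable_const _)
    ((integrable_sq_gaussianReal v).div_const _),
    integral_div, integral_div, integral_sq_gaussianReal]
  simp
  field_simp

lemma meanSquare_of_map_eq {Ω : Type*} [MeasurableSpace Ω] {P : Measure Ω} {Y : Ω → ℝ}
    (hY : AEMeasurable Y P) {v : ℝ≥0} (h : P.map Y = gaussianReal 0 v) : meanSquare P Y = v := by
  rw [meanSquare, ← integral_sq_gaussianReal, ← h, integral_map hY (by fun_prop)]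

lemma memLp_two_of_map_eq {Ω : Type*} [MeasurableSpace Ω] {P : Measure Ω} {Y : Ω → ℝ}
    (hY : AEMeasurable Y P) {v : ℝ≥0} (h : P.map Y = gaussianReal 0 v) : MemLp Y 2 P := by
  have := memLp_id_gaussianReal' (μ := 0) (v := v) 2 (by simp)
  rw [← h] at this
  exact (memLp_map_measure_iff (by fun_prop) hY).1 this

lemma strictMonoOn_entropy : StrictMonoOn
    (fun v : ℝ => Real.log (2 * Real.pi * v) / 2 + 1 / 2) (Ioi 0) := by
  intro a ha b hb hab
  have := Real.log_lt_log (mul_pos Real.two_pi_pos ha)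
    (mul_lt_mul_of_pos_left hab Real.two_pi_pos)
  simp only
  linarith

/-! ### Integrals of the covariance against exponentials -/

/-- Covariance function of fractional Brownian motion. -/
noncomputable def fbmCov (H s u : ℝ) : ℝ :=
  (s ^ (2 * H) + u ^ (2 * H) - |s - u| ^ (2 * H)) / 2

lemma intervalIntegral_inner {E : Type*} [NormedAddCommGroup E] [InnerProductSpace ℝ E]
    [CompleteSpace E] (x : E) {f : ℝ → E} {a b : ℝ} (hf : IntervalIntegrable f volume a b) :
    inner ℝ x (∫ s in a..b, f s) = ∫ s in a..b, inner ℝ x (f s) :=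
  ((innerSL ℝ x).intervalIntegral_comp_comm hf).symm

section Moments

variable {a : ℝ}

/-- The truncated moment `∫₀ˣ vᵃ e^{cv} dv`. -/
noncomputable def expMoment (a c x : ℝ) : ℝ := ∫ v in (0 : ℝ)..x, v ^ a * Real.exp (c * v)

lemma continuous_rpow_mul_exp (ha : 0 ≤ a) (c : ℝ) :
    Continuous fun v : ℝ => v ^ a * Real.exp (c * v) :=
  (Real.continuous_rpow_const ha).mul (by fun_prop)

lemma hasDerivAt_expMoment (ha : 0 ≤ a) (c x : ℝ) :
    HasDerivAt (expMoment a c) (x ^ a * Real.exp (c * x)) x :=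
  ((continuous_rpow_mul_exp ha c).integral_hasStrictDerivAt 0 x).hasDerivAt

lemma continuous_expMoment (ha : 0 ≤ a) (c : ℝ) : Continuous (expMoment a c) :=
  continuous_iff_continuousAt.2 fun x => (hasDerivAt_expMoment ha c x).continuousAt

lemma expMoment_zero (a c : ℝ) : expMoment a c 0 = 0 := by simp [expMoment]

lemma integral_exp_zero (t : ℝ) : ∫ u in (0 : ℝ)..t, Real.exp u = Real.exp t - 1 := by
  simp

/-- The two parts of the integral, over `[0, s]` and `[s, t]`, are shifted truncated moments. -/
lemma integral_exp_mul_abs_rpow (ha : 0 ≤ a) {s t : ℝ} (hs : 0 ≤ s) (hst : s ≤ t) :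
    ∫ u in (0 : ℝ)..t, Real.exp u * |s - u| ^ a =
      Real.exp s * expMoment a (-1) s + Real.exp s * expMoment a 1 (t - s) := by
  have hc : Continuous fun u : ℝ => Real.exp u * |s - u| ^ a :=
    Real.continuous_exp.mul ((Real.continuous_rpow_const ha).comp (by fun_prop))
  rw [← intervalIntegral.integral_add_adjacent_intervals (hc.intervalIntegrable 0 s)
    (hc.intervalIntegrable s t)]
  congr 1
  · rw [expMoment, ← intervalIntegral.integral_const_mul]
    have h := intervalIntegral.integral_comp_sub_left
      (fun v : ℝ => Real.exp s * (v ^ a * Real.exp (-1 * v))) s (a := 0) (b := s)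
    rw [sub_self, sub_zero] at h
    rw [← h]
    refine intervalIntegral.integral_congr fun u hu => ?_
    rw [uIcc_of_le hs] at hu
    rw [abs_of_nonneg (by linarith [hu.2]), mul_left_comm, ← Real.exp_add, mul_comm]
    congr 2
    ring
  · rw [expMoment, ← intervalIntegral.integral_const_mul]
    have h := intervalIntegral.integral_comp_sub_right
      (fun v : ℝ => Real.exp s * (v ^ a * Real.exp (1 * v))) s (a := s) (b := t)
    rw [sub_self] at h
    rw [← h]
    refine intervalIntegral.integral_congr fun u hu => ?_
    rw [uIcc_of_le hst] at hu
    rw [abs_sub_comm, abs_of_nonneg (by linarith [hu.1]), mul_left_comm, ← Real.exp_add, mul_comm]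
    congr 2
    ring

lemma integral_exp_mul_expMoment (ha : 0 ≤ a) (t : ℝ) :
    ∫ s in (0 : ℝ)..t, Real.exp (2 * s) * expMoment a (-1) s =
      (Real.exp (2 * t) * expMoment a (-1) t - expMoment a 1 t) / 2 := by
  rw [intervalIntegral.integral_eq_sub_of_hasDerivAt
    (f := fun s => (Real.exp (2 * s) * expMoment a (-1) s - expMoment a 1 s) / 2)]
  · simp [expMoment_zero]
  · intro s _
    have h2 : HasDerivAt (fun s : ℝ => Real.exp (2 * s)) (Real.exp (2 * s) * 2) s := by
      simpa using ((hasDerivAt_id s).const_mul 2).exp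
    refine (((h2.mul (hasDerivAt_expMoment ha (-1) s)).sub
      (hasDerivAt_expMoment ha 1 s)).div_const 2).congr_deriv ?_
    have : Real.exp (1 * s) = Real.exp (2 * s) * Real.exp (-1 * s) := by
      rw [← Real.exp_add]; congr 1; ring
    rw [this]
    ring
  · exact ((by fun_prop : Continuous fun s : ℝ => Real.exp (2 * s)).mul
      (continuous_expMoment ha _)).intervalIntegrable _ _

lemma integral_exp_mul_expMoment_sub (ha : 0 ≤ a) (t : ℝ) :
    ∫ s in (0 : ℝ)..t, Real.exp (2 * s) * expMoment a 1 (t - s) =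
      (Real.exp (2 * t) * expMoment a (-1) t - expMoment a 1 t) / 2 := by
  rw [intervalIntegral.integral_eq_sub_of_hasDerivAt
    (f := fun s => (Real.exp (2 * s) * expMoment a 1 (t - s)
      - Real.exp (2 * t) * expMoment a (-1) (t - s)) / 2)]
  · simp [expMoment_zero]
    ring
  · intro s _
    have h2 : HasDerivAt (fun s : ℝ => Real.exp (2 * s)) (Real.exp (2 * s) * 2) s := by
      simpa using ((hasDerivAt_id s).const_mul 2).exp
    have hs : HasDerivAt (fun s => t - s) (-1) s := (hasDerivAt_id s).const_sub t
    refine (((h2.mul ((hasDerivAt_expMoment ha 1 (t - s)).comp s hs)).sub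
      (((hasDerivAt_expMoment ha (-1) (t - s)).comp s hs).const_mul _)).div_const 2).congr_deriv ?_
    have : Real.exp (2 * t) * Real.exp (-1 * (t - s)) =
        Real.exp (2 * s) * Real.exp (1 * (t - s)) := by
      rw [← Real.exp_add, ← Real.exp_add]; congr 1; ring
    simp only [Function.comp]
    linear_combination (t - s) ^ a * this / 2
  · exact ((by fun_prop : Continuous fun s : ℝ => Real.exp (2 * s)).mul
      ((continuous_expMoment ha _).comp (by fun_prop))).intervalIntegrable _ _

lemma integral_exp_mul_rpow (a t : ℝ) :
    ∫ u in (0 : ℝ)..t, Real.exp u * u ^ a = expMoment a 1 t := by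
  simp only [expMoment, one_mul, mul_comm (Real.exp _)]

lemma integral_exp_mul_fbmCov {H : ℝ} (hH : 0 ≤ H) {s t : ℝ} (hs : 0 ≤ s) (hst : s ≤ t) :
    ∫ u in (0 : ℝ)..t, Real.exp u * fbmCov H s u =
      (s ^ (2 * H) * (Real.exp t - 1) + expMoment (2 * H) 1 t
        - Real.exp s * expMoment (2 * H) (-1) s
        - Real.exp s * expMoment (2 * H) 1 (t - s)) / 2 := by
  have ha : 0 ≤ 2 * H := by linarith
  have h1 : Continuous fun u : ℝ => Real.exp u * u ^ (2 * H) :=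
    Real.continuous_exp.mul (Real.continuous_rpow_const ha)
  have h2 : Continuous fun u : ℝ => Real.exp u * |s - u| ^ (2 * H) :=
    Real.continuous_exp.mul ((Real.continuous_rpow_const ha).comp (by fun_prop))
  have h0 : Continuous fun u : ℝ => s ^ (2 * H) * Real.exp u := by fun_prop
  have heq : ∀ u, Real.exp u * fbmCov H s u = (s ^ (2 * H) * Real.exp u +
      Real.exp u * u ^ (2 * H) - Real.exp u * |s - u| ^ (2 * H)) / 2 := fun u => by
    rw [fbmCov]; ring
  simp only [heq]
  rw [intervalIntegral.integral_div, intervalIntegral.integral_sub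
    ((h0.fun_add h1).intervalIntegrable _ _) (h2.intervalIntegrable _ _),
    intervalIntegral.integral_add (h0.intervalIntegrable _ _) (h1.intervalIntegrable _ _),
    intervalIntegral.integral_const_mul, integral_exp_zero, integral_exp_mul_rpow,
    integral_exp_mul_abs_rpow ha hs hst]
  ring

lemma integral_integral_exp_mul_fbmCov {H : ℝ} (hH : 0 ≤ H) {t : ℝ} (ht : 0 ≤ t) :
    ∫ s in (0 : ℝ)..t, Real.exp s * ∫ u in (0 : ℝ)..t, Real.exp u * fbmCov H s u =
      (Real.exp t - 1) * expMoment (2 * H) 1 t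
        - (Real.exp (2 * t) * expMoment (2 * H) (-1) t - expMoment (2 * H) 1 t) / 2 := by
  have ha : 0 ≤ 2 * H := by linarith
  have h2e : Continuous fun s : ℝ => Real.exp (2 * s) := by fun_prop
  have h1 : Continuous fun s : ℝ => (Real.exp t - 1) * (Real.exp s * s ^ (2 * H)) :=
    continuous_const.mul (Real.continuous_exp.mul (Real.continuous_rpow_const ha))
  have h2 : Continuous fun s : ℝ => expMoment (2 * H) 1 t * Real.exp s := by fun_prop
  have h3 : Continuous fun s : ℝ => Real.exp (2 * s) * expMoment (2 * H) (-1) s :=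
    h2e.mul (continuous_expMoment ha _)
  have h4 : Continuous fun s : ℝ => Real.exp (2 * s) * expMoment (2 * H) 1 (t - s) :=
    h2e.mul ((continuous_expMoment ha _).comp (by fun_prop))
  have heq : ∫ s in (0 : ℝ)..t, Real.exp s * ∫ u in (0 : ℝ)..t, Real.exp u * fbmCov H s u =
      ∫ s in (0 : ℝ)..t, ((Real.exp t - 1) * (Real.exp s * s ^ (2 * H)) +
        expMoment (2 * H) 1 t * Real.exp s - Real.exp (2 * s) * expMoment (2 * H) (-1) s -
        Real.exp (2 * s) * expMoment (2 * H) 1 (t - s)) / 2 := by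
    refine intervalIntegral.integral_congr fun s hs => ?_
    rw [uIcc_of_le ht] at hs
    rw [integral_exp_mul_fbmCov hH hs.1 hs.2, two_mul s, Real.exp_add]
    ring
  rw [heq, intervalIntegral.integral_div, intervalIntegral.integral_sub
    (((h1.fun_add h2).fun_sub h3).intervalIntegrable _ _) (h4.intervalIntegrable _ _),
    intervalIntegral.integral_sub ((h1.fun_add h2).intervalIntegrable _ _)
      (h3.intervalIntegrable _ _),
    intervalIntegral.integral_add (h1.intervalIntegrable _ _) (h2.intervalIntegrable _ _),
    intervalIntegral.integral_const_mul, intervalIntegral.integral_const_mul,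
    integral_exp_mul_rpow, integral_exp_zero, integral_exp_mul_expMoment ha,
    integral_exp_mul_expMoment_sub ha]
  ring

lemma expVariance_eq_expMoment {H : ℝ} (hH : 0 ≤ H) (t : ℝ) :
    expVariance t H = Real.exp t * t ^ (2 * H) +
      (Real.exp (2 * t) * expMoment (2 * H) (-1) t - expMoment (2 * H) 1 t) / 2 := by
  have ha : 0 ≤ 2 * H := by linarith
  rw [expVariance, sinhTransform, mul_add, expMoment, expMoment,
    ← intervalIntegral.integral_const_mul, ← intervalIntegral.integral_const_mul,
    ← intervalIntegral.integral_sub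
      ((continuous_const.fun_mul (continuous_rpow_mul_exp ha _)).intervalIntegrable _ _)
      ((continuous_rpow_mul_exp ha _).intervalIntegrable _ _),
    ← intervalIntegral.integral_div]
  congr 1
  refine intervalIntegral.integral_congr fun s _ => ?_
  have h1 : Real.exp (2 * t) * Real.exp (-1 * s) = Real.exp t * Real.exp (t - s) := by
    rw [← Real.exp_add, ← Real.exp_add]; congr 1; ring
  have h2 : Real.exp (1 * s) = Real.exp t * Real.exp (-(t - s)) := by
    rw [← Real.exp_add]; congr 1; ring
  simp only [Real.sinh_eq]
  linear_combination -(s ^ (2 * H)) * h1 / 2 + s ^ (2 * H) * h2 / 2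

end Moments

/-! ### Exponential Wiener integrals in a Hilbert space -/

section Hilbert

variable {E : Type*} [NormedAddCommGroup E] [InnerProductSpace ℝ E] {H : ℝ} {β : ℝ → E}

lemma norm_sq_of_fbmCov (hH : 0 < H)
    (hβ : ∀ s u, 0 ≤ s → 0 ≤ u → inner ℝ (β s) (β u) = fbmCov H s u) {s : ℝ} (hs : 0 ≤ s) :
    ‖β s‖ ^ 2 = s ^ (2 * H) := by
  rw [← real_inner_self_eq_norm_sq, hβ s s hs hs, fbmCov, sub_self, abs_zero,
    Real.zero_rpow (by linarith)]
  ring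

lemma norm_sub_of_fbmCov (hH : 0 < H)
    (hβ : ∀ s u, 0 ≤ s → 0 ≤ u → inner ℝ (β s) (β u) = fbmCov H s u) {s u : ℝ} (hs : 0 ≤ s)
    (hu : 0 ≤ u) : ‖β s - β u‖ = |s - u| ^ H := by
  rw [← sq_eq_sq₀ (norm_nonneg _) (Real.rpow_nonneg (abs_nonneg _) _), norm_sub_sq_real,
    norm_sq_of_fbmCov hH hβ hs, norm_sq_of_fbmCov hH hβ hu, hβ s u hs hu, fbmCov,
    ← Real.rpow_mul_natCast (abs_nonneg _), mul_comm H]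
  push_cast
  ring

lemma continuousOn_of_fbmCov (hH : 0 < H)
    (hβ : ∀ s u, 0 ≤ s → 0 ≤ u → inner ℝ (β s) (β u) = fbmCov H s u) :
    ContinuousOn β (Ici 0) := by
  intro s hs
  rw [ContinuousWithinAt, tendsto_iff_norm_sub_tendsto_zero]
  have h : Filter.Tendsto (fun u : ℝ => |u - s| ^ H) (nhdsWithin s (Ici 0)) (nhds 0) := by
    have hc : Continuous fun u : ℝ => |u - s| ^ H :=
      (Real.continuous_rpow_const hH.le).comp (by fun_prop)
    have := hc.tendsto s
    simp only [sub_self, abs_zero, Real.zero_rpow hH.ne'] at this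
    exact this.mono_left nhdsWithin_le_nhds
  refine h.congr' ?_
  filter_upwards [self_mem_nhdsWithin] with u hu
  exact (norm_sub_of_fbmCov hH hβ hu hs).symm

lemma sum_smul_sub_succ {M : Type*} [AddCommGroup M] [Module ℝ M] (c : ℕ → ℝ) (b : ℕ → M) (n : ℕ) :
    ∑ i ∈ Finset.range n, c i • (b (i + 1) - b i) =
      c n • b n - c 0 • b 0 - ∑ i ∈ Finset.range n, (c (i + 1) - c i) • b (i + 1) := by
  induction n with
  | zero => simp
  | succ n ih =>
    rw [Finset.sum_range_succ, Finset.sum_range_succ, ih]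
    module

variable [CompleteSpace E]

/-- The Wiener integral of `exp` over `[0, t]` against a Hilbert-space curve that starts at `0`,
after integration by parts. -/
noncomputable def expWiener (β : ℝ → E) (t : ℝ) : E :=
  Real.exp t • β t - ∫ s in (0 : ℝ)..t, Real.exp s • β s

/-- Summation by parts turns the Riemann sum into `eᵗ β t` minus the integral of a step function,
which is `(t / n) ^ H`-close to `β` by Hölder continuity. -/
lemma norm_riemannSum_sub_expWiener_le (hH : 0 < H)
    (hβ : ∀ s u, 0 ≤ s → 0 ≤ u → inner ℝ (β s) (β u) = fbmCov H s u) {t : ℝ} (ht : 0 ≤ t)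
    {n : ℕ} (hn : n ≠ 0) :
    ‖∑ i ∈ Finset.range n, Real.exp (i * (t / n)) • (β ((i + 1 : ℕ) * (t / n)) - β (i * (t / n)))
      - expWiener β t‖ ≤ Real.exp t * (t / n) ^ H * t := by
  set x : ℕ → ℝ := fun i => i * (t / n) with hx
  have hn0 : (0 : ℝ) < n := Nat.cast_pos.2 (Nat.pos_of_ne_zero hn)
  have hd : 0 ≤ t / n := div_nonneg ht hn0.le
  have hx0 : ∀ i, 0 ≤ x i := fun i => mul_nonneg (Nat.cast_nonneg i) hd
  have hxs : ∀ i, x (i + 1) = x i + t / n := fun i => by simp only [hx]; push_cast; ring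
  have hxn : x n = t := mul_div_cancel₀ t hn0.ne'
  have hxz : x 0 = 0 := by simp [hx]
  have hβ0 : β 0 = 0 := by
    have := norm_sq_of_fbmCov hH hβ le_rfl
    rwa [Real.zero_rpow (by linarith), sq_eq_zero_iff, norm_eq_zero] at this
  have hcont := continuousOn_of_fbmCov hH hβ
  have hint : ∀ a b, 0 ≤ a → 0 ≤ b → IntervalIntegrable (fun s => Real.exp s • β s) volume a b :=
    fun a b ha hb => ((Real.continuous_exp.continuousOn.smul hcont).mono
      fun s hs => (le_min ha hb).trans hs.1).intervalIntegrable
  have hpiece : ∀ i, (Real.exp (x (i + 1)) - Real.exp (x i)) • β (x (i + 1)) =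
      ∫ s in x i..x (i + 1), Real.exp s • β (x (i + 1)) := fun i => by
    rw [intervalIntegral.integral_smul_const, integral_exp]
  have hdiff : ∑ i ∈ Finset.range n, Real.exp (x i) • (β (x (i + 1)) - β (x i)) - expWiener β t =
      ∑ i ∈ Finset.range n, ∫ s in x i..x (i + 1), Real.exp s • (β s - β (x (i + 1))) := by
    rw [sum_smul_sub_succ (fun i => Real.exp (x i)) (fun i => β (x i)), expWiener, hxn, hxz, hβ0,
      smul_zero, sub_zero, sub_sub_sub_cancel_left]
    have h := intervalIntegral.sum_integral_adjacent_intervals (n := n) (a := x) (μ := volume)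
      fun k _ => hint _ _ (hx0 k) (hx0 (k + 1))
    rw [hxn, hxz] at h
    rw [← h, ← Finset.sum_sub_distrib]
    refine Finset.sum_congr rfl fun i _ => ?_
    rw [hpiece, ← intervalIntegral.integral_sub (hint _ _ (hx0 i) (hx0 (i + 1)))
      (Continuous.intervalIntegrable (by fun_prop) _ _)]
    simp only [smul_sub]
  change ‖∑ i ∈ Finset.range n, Real.exp (x i) • (β (x (i + 1)) - β (x i)) - expWiener β t‖ ≤ _
  rw [hdiff]
  have hle : ∀ i ∈ Finset.range n,
      ‖∫ s in x i..x (i + 1), Real.exp s • (β s - β (x (i + 1)))‖ ≤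
        Real.exp t * (t / n) ^ H * (t / n) := fun i hi => by
    have hi' : x (i + 1) ≤ t := by
      rw [← hxn]
      exact mul_le_mul_of_nonneg_right (Nat.cast_le.2 (Finset.mem_range.1 hi)) hd
    have hxi : x i ≤ x (i + 1) := by rw [hxs]; linarith
    have h := intervalIntegral.norm_integral_le_of_norm_le_const (a := x i) (b := x (i + 1))
      (f := fun s => Real.exp s • (β s - β (x (i + 1)))) (C := Real.exp t * (t / n) ^ H)
      fun s hs => ?_
    · have hw : |x (i + 1) - x i| = t / n := by rw [hxs, add_sub_cancel_left, abs_of_nonneg hd]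
      rwa [hw] at h
    · rw [uIoc_of_le hxi] at hs
      rw [norm_smul, Real.norm_eq_abs, Real.abs_exp,
        norm_sub_of_fbmCov hH hβ ((hx0 i).trans hs.1.le) (hx0 _)]
      refine mul_le_mul (Real.exp_le_exp.2 (hs.2.trans hi')) ?_
        (Real.rpow_nonneg (abs_nonneg _) _) (Real.exp_pos _).le
      refine Real.rpow_le_rpow (abs_nonneg _) ?_ hH.le
      rw [abs_sub_comm, abs_of_nonneg (by linarith [hs.2])]
      linarith [hs.1, hxs i]
  refine (norm_sum_le_of_le _ hle).trans_eq ?_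
  rw [Finset.sum_const, Finset.card_range, nsmul_eq_mul]
  field_simp

/-- The squared norm expands into integrals of the covariance. -/
lemma norm_expWiener_sq (hH : 0 < H)
    (hβ : ∀ s u, 0 ≤ s → 0 ≤ u → inner ℝ (β s) (β u) = fbmCov H s u) {t : ℝ} (ht : 0 ≤ t) :
    ‖expWiener β t‖ ^ 2 = expVariance t H := by
  set I := ∫ s in (0 : ℝ)..t, Real.exp s • β s with hI
  have hint : IntervalIntegrable (fun s => Real.exp s • β s) volume 0 t :=
    ((Real.continuous_exp.continuousOn.smul (continuousOn_of_fbmCov hH hβ)).mono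
      fun s hs => (le_min le_rfl ht).trans hs.1).intervalIntegrable
  have h1 : ∀ s, 0 ≤ s → inner ℝ (β s) I = ∫ u in (0 : ℝ)..t, Real.exp u * fbmCov H s u :=
    fun s hs => by
      rw [hI, intervalIntegral_inner _ hint]
      refine intervalIntegral.integral_congr fun u hu => ?_
      rw [uIcc_of_le ht] at hu
      simp only [inner_smul_right, hβ s u hs hu.1]
  have h2 : inner ℝ I I =
      ∫ s in (0 : ℝ)..t, Real.exp s * ∫ u in (0 : ℝ)..t, Real.exp u * fbmCov H s u := by
    conv_lhs => arg 3; rw [hI]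
    rw [intervalIntegral_inner _ hint]
    refine intervalIntegral.integral_congr fun s hs => ?_
    rw [uIcc_of_le ht] at hs
    simp only [inner_smul_right, real_inner_comm, h1 s hs.1]
  rw [expWiener, ← hI, norm_sub_sq_real, ← real_inner_self_eq_norm_sq I, h2,
    integral_integral_exp_mul_fbmCov hH.le ht, real_inner_smul_left, h1 t ht,
    integral_exp_mul_fbmCov hH.le ht le_rfl, norm_smul, mul_pow, norm_sq_of_fbmCov hH hβ ht,
    sub_self, expMoment_zero, expVariance_eq_expMoment hH.le, Real.norm_eq_abs, Real.abs_exp,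
    two_mul t, Real.exp_add]
  ring

/-- The squared norms of the Riemann sums converge to the closed form of the variance. -/
lemma tendsto_norm_riemannSum_sq (hH : 0 < H)
    (hβ : ∀ s u, 0 ≤ s → 0 ≤ u → inner ℝ (β s) (β u) = fbmCov H s u) {t : ℝ} (ht : 0 ≤ t) :
    Filter.Tendsto (fun n : ℕ => ‖∑ i ∈ Finset.range n,
      Real.exp (i * (t / n)) • (β ((i + 1 : ℕ) * (t / n)) - β (i * (t / n)))‖ ^ 2)
      Filter.atTop (nhds (expVariance t H)) := by
  rw [← norm_expWiener_sq hH hβ ht]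
  refine (Filter.Tendsto.norm ?_).pow 2
  rw [tendsto_iff_norm_sub_tendsto_zero]
  have hlim : Filter.Tendsto (fun n : ℕ => Real.exp t * (t / n) ^ H * t) Filter.atTop
      (nhds 0) := by
    have h := ((tendsto_const_div_atTop_nhds_zero_nat t).rpow_const (Or.inr hH.le)
      |>.const_mul (Real.exp t)).mul_const t
    simpa [Real.zero_rpow hH.ne'] using h
  refine squeeze_zero' (Filter.Eventually.of_forall fun _ => norm_nonneg _) ?_ hlim
  filter_upwards [Filter.eventually_ne_atTop 0] with n hn
  exact norm_riemannSum_sub_expWiener_le hH hβ ht hn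

end Hilbert

/-! ### The law of the process -/

section Limit

variable {Ω : Type*} [MeasurableSpace Ω] {P : Measure Ω}

/-- An almost sure limit of centred Gaussian variables with convergent variances is Gaussian:
the characteristic functions converge. -/
lemma map_eq_gaussianReal_of_tendsto [IsProbabilityMeasure P] {S : ℕ → Ω → ℝ} {Y : Ω → ℝ}
    {v : ℝ} (hv : 0 ≤ v) (hS : ∀ n, HasGaussianLaw (S n) P) (hmean : ∀ n, ∫ ω, S n ω ∂P = 0)
    (hvar : Filter.Tendsto (fun n => ∫ ω, S n ω ^ 2 ∂P) Filter.atTop (nhds v))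
    (hlim : ∀ᵐ ω ∂P, Filter.Tendsto (fun n => S n ω) Filter.atTop (nhds (Y ω))) :
    AEMeasurable Y P ∧ P.map Y = gaussianReal 0 v.toNNReal := by
  have hY : AEMeasurable Y P :=
    aemeasurable_of_tendsto_metrizable_ae Filter.atTop (fun n => (hS n).aemeasurable) hlim
  have := P.isProbabilityMeasure_map hY
  refine ⟨hY, Measure.ext_of_charFun (funext fun u => ?_)⟩
  have hmeas : ∀ Z : Ω → ℝ, AEMeasurable Z P →
      charFun (P.map Z) u = ∫ ω, Complex.exp (u * Z ω * Complex.I) ∂P := fun Z hZ => by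
    rw [charFun_apply_real, integral_map hZ (by fun_prop)]
  have hchar : ∀ n, charFun (P.map (S n)) u =
      Complex.exp (-((∫ ω, S n ω ^ 2 ∂P : ℝ) : ℂ) * u ^ 2 / 2) := fun n => by
    rw [(hS n).map_eq_gaussianReal, charFun_gaussianReal, hmean n,
      variance_of_integral_eq_zero (hS n).aemeasurable (hmean n),
      Real.coe_toNNReal _ (integral_nonneg fun ω => sq_nonneg _)]
    congr 1
    push_cast
    ring
  have h1 : Filter.Tendsto (fun n => charFun (P.map (S n)) u) Filter.atTop
      (nhds (charFun (P.map Y) u)) := by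
    rw [hmeas Y hY]
    simp only [fun n => hmeas (S n) (hS n).aemeasurable]
    refine tendsto_integral_of_dominated_convergence (fun _ => 1) (fun n => ?_)
      (integrable_const _) (fun n => Filter.Eventually.of_forall fun ω => ?_) ?_
    · have := (hS n).aemeasurable
      exact AEMeasurable.aestronglyMeasurable (by fun_prop)
    · rw [← Complex.ofReal_mul, Complex.norm_exp_ofReal_mul_I]
    · filter_upwards [hlim] with ω hω
      have hc : Continuous fun y : ℝ => Complex.exp (u * y * Complex.I) := by fun_prop
      exact (hc.tendsto _).comp hω
  have h2 : Filter.Tendsto (fun n => charFun (P.map (S n)) u) Filter.atTop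
      (nhds (charFun (gaussianReal 0 v.toNNReal) u)) := by
    simp only [hchar]
    have hc : Continuous fun y : ℝ => Complex.exp (-(y : ℂ) * u ^ 2 / 2) := by fun_prop
    have h := (hc.tendsto v).comp hvar
    have hv' : charFun (gaussianReal 0 v.toNNReal) u = Complex.exp (-(v : ℂ) * u ^ 2 / 2) := by
      rw [charFun_gaussianReal, Real.coe_toNNReal v hv]
      congr 1
      push_cast
      ring
    rw [hv']
    exact h
  exact tendsto_nhds_unique h1 h2

/-- Riemann sums over the uniform partition with left end points as tags. -/
lemma HasRSIntegral.tendsto_uniform {f g : ℝ≥0 → ℝ} {t : ℝ≥0} {I : ℝ}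
    (h : HasRSIntegral f g t I) :
    Filter.Tendsto (fun n : ℕ => ∑ i ∈ Finset.range n,
      f (i * (t / n)) * (g ((i + 1 : ℕ) * (t / n)) - g (i * (t / n)))) Filter.atTop (nhds I) := by
  rw [Metric.tendsto_atTop]
  intro ε hε
  obtain ⟨δ, hδ, hsum⟩ := h ε hε
  have hlim : ∀ᶠ n : ℕ in Filter.atTop, t / n < δ := by
    filter_upwards [(tendsto_order.1 (tendsto_const_div_atTop_nhds_zero_nat (t : ℝ))).2 δ hδ]
      with n hn
    exact_mod_cast hn
  obtain ⟨N, hN⟩ := Filter.eventually_atTop.1 (hlim.and (Filter.eventually_ne_atTop 0))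
  refine ⟨N, fun n hn => ?_⟩
  obtain ⟨hn1, hn2⟩ := hN n hn
  rw [Real.dist_eq]
  refine hsum n (fun i => i * (t / n)) (fun i => i * (t / n)) (by simp)
    (mul_div_cancel₀ t (Nat.cast_ne_zero.2 hn2)) fun i _ => ⟨le_rfl, ?_, ?_⟩
  · push_cast
    gcongr
    simp
  · push_cast
    rw [add_mul, one_mul]
    gcongr

lemma hasGaussianLaw_sum_increments {B : ℝ≥0 → Ω → ℝ} (hB : IsGaussianProcess B P) (n : ℕ)
    (c : ℕ → ℝ) (x : ℕ → ℝ≥0) :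
    HasGaussianLaw (fun ω => ∑ i ∈ Finset.range n, c i * (B (x (i + 1)) ω - B (x i) ω)) P := by
  have h := (hB.hasGaussianLaw_increments (n := n) (t := fun i => x i)).map_fun
    (∑ i : Fin n, c i • ContinuousLinearMap.proj (R := ℝ) (φ := fun _ => ℝ) i)
  refine h.congr (Filter.Eventually.of_forall fun ω => ?_)
  simp only
  rw [Finset.sum_range]
  simp

variable {H : ℝ} {B : ℝ≥0 → Ω → ℝ}

/-- A fractional Brownian motion as a curve in `L²`, extended by a constant to negative times. -/
noncomputable def IsFractionalBM.curve (hB : IsFractionalBM H B P) (s : ℝ) : Lp ℝ 2 P :=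
  (hB.gaussian.hasGaussianLaw_eval s.toNNReal).memLp_two.toLp

lemma IsFractionalBM.inner_curve (hB : IsFractionalBM H B P) (s u : ℝ) (hs : 0 ≤ s)
    (hu : 0 ≤ u) : inner ℝ (hB.curve s) (hB.curve u) = fbmCov H s u := by
  have h := hB.covariance s.toNNReal u.toNNReal
  rw [Real.coe_toNNReal s hs, Real.coe_toNNReal u hu] at h
  rw [fbmCov, ← h, L2.inner_def]
  refine integral_congr_ae ?_
  filter_upwards [(hB.gaussian.hasGaussianLaw_eval s.toNNReal).memLp_two.coeFn_toLp,
    (hB.gaussian.hasGaussianLaw_eval u.toNNReal).memLp_two.coeFn_toLp] with ω h1 h2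
  rw [curve, curve, h1, h2]
  simp [mul_comm]

lemma IsFractionalBM.coeFn_sum_curve (hB : IsFractionalBM H B P) (n : ℕ) (c x : ℕ → ℝ) :
    (∑ i ∈ Finset.range n, c i • (hB.curve (x (i + 1)) - hB.curve (x i)) : Lp ℝ 2 P) =ᵐ[P]
      fun ω => ∑ i ∈ Finset.range n,
        c i * (B (x (i + 1)).toNNReal ω - B (x i).toNNReal ω) := by
  induction n with
  | zero =>
    simp only [Finset.range_zero, Finset.sum_empty]
    exact Lp.coeFn_zero ℝ 2 P
  | succ n ih =>
    simp only [Finset.sum_range_succ]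
    filter_upwards [ih, Lp.coeFn_add
        (∑ i ∈ Finset.range n, c i • (hB.curve (x (i + 1)) - hB.curve (x i)))
        (c n • (hB.curve (x (n + 1)) - hB.curve (x n))),
      Lp.coeFn_smul (c n) (hB.curve (x (n + 1)) - hB.curve (x n)),
      Lp.coeFn_sub (hB.curve (x (n + 1))) (hB.curve (x n)),
      (hB.gaussian.hasGaussianLaw_eval (x (n + 1)).toNNReal).memLp_two.coeFn_toLp,
      (hB.gaussian.hasGaussianLaw_eval (x n).toNNReal).memLp_two.coeFn_toLp]
      with ω h1 h2 h3 h4 h5 h6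
    rw [h2, Pi.add_apply, h1, h3, Pi.smul_apply, h4, Pi.sub_apply, curve, curve, h5, h6,
      smul_eq_mul]

lemma IsFractionalBM.integral_sum_sq (hB : IsFractionalBM H B P) (n : ℕ) (c x : ℕ → ℝ) :
    ∫ ω, (∑ i ∈ Finset.range n,
        c i * (B (x (i + 1)).toNNReal ω - B (x i).toNNReal ω)) ^ 2 ∂P =
      ‖∑ i ∈ Finset.range n, c i • (hB.curve (x (i + 1)) - hB.curve (x i))‖ ^ 2 := by
  rw [← real_inner_self_eq_norm_sq, L2.inner_def]
  refine integral_congr_ae ?_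
  filter_upwards [hB.coeFn_sum_curve n c x] with ω hω
  rw [hω, real_inner_self_eq_norm_sq, Real.norm_eq_abs, sq_abs]

lemma IsFractionalBM.integral_sum_eq_zero (hB : IsFractionalBM H B P) (n : ℕ) (c : ℕ → ℝ)
    (x : ℕ → ℝ≥0) :
    ∫ ω, ∑ i ∈ Finset.range n, c i * (B (x (i + 1)) ω - B (x i) ω) ∂P = 0 := by
  have hint := fun s => (hB.gaussian.hasGaussianLaw_eval s).integrable
  have hinc : ∀ i, Integrable (fun ω => c i * (B (x (i + 1)) ω - B (x i) ω)) P := fun i =>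
    ((hint _).sub (hint _)).const_mul _
  rw [integral_finsetSum _ fun i _ => hinc i]
  refine Finset.sum_eq_zero fun i _ => ?_
  rw [integral_const_mul, integral_sub (hint _) (hint _), hB.mean_zero, hB.mean_zero, sub_zero,
    mul_zero]

/-- Almost sure convergence identifies the limit of the Riemann sums as `X t`, and convergence in
`L²` of the curve gives its variance. -/
lemma IsExpWienerIntegral.map_eq [IsProbabilityMeasure P] (hH : 0 < H) {X : ℝ≥0 → Ω → ℝ}
    (hX : IsExpWienerIntegral H X P) {t : ℝ≥0} (ht : 0 < t) :
    AEMeasurable (X t) P ∧ P.map (X t) = gaussianReal 0 (expVariance t H).toNNReal := by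
  obtain ⟨B, hB, hint⟩ := hX
  refine map_eq_gaussianReal_of_tendsto (expVariance_pos (NNReal.coe_pos.2 ht) H).le
    (S := fun n ω => ∑ i ∈ Finset.range n, Real.exp ((i * (t / n) : ℝ≥0) : ℝ) *
      (B ((i + 1 : ℕ) * (t / n)) ω - B (i * (t / n)) ω))
    (fun n => hasGaussianLaw_sum_increments hB.gaussian n
      (fun i => Real.exp ((i * (t / n) : ℝ≥0) : ℝ)) fun i => i * (t / n))
    (fun n => hB.integral_sum_eq_zero n
      (fun i => Real.exp ((i * (t / n) : ℝ≥0) : ℝ)) fun i => i * (t / n)) ?_ ?_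
  · refine (tendsto_norm_riemannSum_sq hH hB.inner_curve (NNReal.coe_nonneg t)).congr fun n => ?_
    rw [← hB.integral_sum_sq n (fun i => Real.exp (i * (t / n))) fun i => i * (t / n)]
    have hx : ∀ i : ℕ, Real.toNNReal (i * ((t : ℝ) / n)) = i * (t / n) := fun i => by
      rw [← Real.toNNReal_coe (r := i * (t / n))]
      push_cast
      rfl
    simp only [hx]
    push_cast
    rfl
  · filter_upwards [hint t] with ω hω
    exact hω.tendsto_uniform

lemma IsEWIFGZero.map_eq {X : ℝ≥0 → Ω → ℝ} (hX : IsEWIFGZero X P) {t : ℝ≥0} (ht : 0 < t) :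
    AEMeasurable (X t) P ∧ P.map (X t) = gaussianReal 0 (expVariance t 0).toNNReal := by
  have hG := hX.gaussian.hasGaussianLaw_eval t
  refine ⟨hG.aemeasurable, ?_⟩
  have h := hX.covariance t t
  rw [covZero, min_self, if_neg ht.ne', if_pos rfl, ← expVariance_zero] at h
  rw [hG.map_eq_gaussianReal, hX.mean_zero,
    variance_of_integral_eq_zero hG.aemeasurable (hX.mean_zero t), ← h]
  simp only [sq]

lemma IsEWIFG.map_eq [IsProbabilityMeasure P] {X : ℝ≥0 → Ω → ℝ} (hX : IsEWIFG H X P) {t : ℝ≥0}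
    (ht : 0 < t) :
    AEMeasurable (X t) P ∧ P.map (X t) = gaussianReal 0 (expVariance t H).toNNReal := by
  rcases hX with ⟨rfl, hX⟩ | ⟨hH, _, hX⟩
  · exact hX.map_eq ht
  · exact hX.map_eq hH ht

end Limit

/-! ### Transfer to variance and entropy -/

lemma DecreasesThenIncreases.congr {f g : ℝ → ℝ} {a : ℝ} (h : DecreasesThenIncreases f a)
    (ha : a ∈ Icc (0 : ℝ) 1) (hfg : EqOn f g (Icc 0 1)) : DecreasesThenIncreases g a :=
  ⟨h.1.congr (hfg.mono (Icc_subset_Icc_right ha.2)),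
    h.2.congr (hfg.mono (Icc_subset_Icc_left ha.1))⟩

lemma DecreasesThenIncreases.comp {φ f : ℝ → ℝ} {a : ℝ} {s : Set ℝ} (hφ : StrictMonoOn φ s)
    (h : DecreasesThenIncreases f a) (hf : ∀ x, f x ∈ s) :
    DecreasesThenIncreases (fun x => φ (f x)) a :=
  ⟨fun _ hx _ hy hxy => hφ (hf _) (hf _) (h.1 hx hy hxy),
    fun _ hx _ hy hxy => hφ (hf _) (hf _) (h.2 hx hy hxy)⟩


theorem corollary3p6 :
    ∃ τ₁ τh : ℝ, 1 < τ₁ ∧ τ₁ < Real.log 3 ∧ Real.log 3 < τh ∧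
      ∀ (Ω : ℝ → Type*) [∀ H, MeasurableSpace (Ω H)] (P : ∀ H, Measure (Ω H))
        [∀ H, IsProbabilityMeasure (P H)] (X : ∀ H, ℝ≥0 → Ω H → ℝ),
        (∀ H ∈ Icc (0 : ℝ) 1, IsEWIFG H (X H) (P H)) →
        ∀ t : ℝ≥0, 0 < t →
          -- variance and entropy are well defined
          (∀ H ∈ Icc (0 : ℝ) 1,
            MemLp (X H t) 2 (P H) ∧ HasShannonEntropy (P H) (X H t)) ∧
          -- `τ₁` and `τh` are the zeros of the derivatives in `H` at `1` and at `1 / 2`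
          (∃ d, HasDerivWithinAt (fun H => meanSquare (P H) (X H t)) d (Icc 0 1) 1 ∧
            SignType.sign d = SignType.sign ((t : ℝ) - τ₁)) ∧
          (∃ d, HasDerivAt (fun H => meanSquare (P H) (X H t)) d (1 / 2) ∧
            SignType.sign d = SignType.sign ((t : ℝ) - τh)) ∧
          -- the behaviour on `[0, 1]`
          ((t : ℝ) ≤ τ₁ →
            StrictAntiOn (fun H => meanSquare (P H) (X H t)) (Icc 0 1) ∧
            StrictAntiOn (fun H => shannonEntropy (P H) (X H t)) (Icc 0 1)) ∧
          (τ₁ < t → (t : ℝ) < τh → ∃ a ∈ Ioo (1 / 2 : ℝ) 1,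
            DecreasesThenIncreases (fun H => meanSquare (P H) (X H t)) a ∧
            DecreasesThenIncreases (fun H => shannonEntropy (P H) (X H t)) a) ∧
          ((t : ℝ) = τh →
            DecreasesThenIncreases (fun H => meanSquare (P H) (X H t)) (1 / 2) ∧
            DecreasesThenIncreases (fun H => shannonEntropy (P H) (X H t)) (1 / 2)) ∧
          (τh < t → ∃ a ∈ Ioo (0 : ℝ) (1 / 2),
            DecreasesThenIncreases (fun H => meanSquare (P H) (X H t)) a ∧
            DecreasesThenIncreases (fun H => shannonEntropy (P H) (X H t)) a) := by

  obtain ⟨τ₁, τh, hτ₁, hτ₁3, hτh, hsign⟩ := exists_critical_times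
  refine ⟨τ₁, τh, hτ₁, hτ₁3, hτh, fun Ω _ P _ X hX t ht => ?_⟩
  have ht' : (0 : ℝ) < t := NNReal.coe_pos.2 ht
  obtain ⟨hs₁, hsh⟩ := hsign t ht'
  have hlaw := fun H hH => (hX H hH).map_eq ht
  have hpos : ∀ H, 0 < expVariance t H := expVariance_pos ht'
  have hne : ∀ H, (expVariance t H).toNNReal ≠ 0 := fun H => (Real.toNNReal_pos.2 (hpos H)).ne'
  have hV : EqOn (expVariance t) (fun H => meanSquare (P H) (X H t)) (Icc 0 1) := fun H hH => by
    simp only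
    rw [meanSquare_of_map_eq (hlaw H hH).1 (hlaw H hH).2, Real.coe_toNNReal _ (hpos H).le]
  have hE : EqOn (fun H => Real.log (2 * Real.pi * expVariance t H) / 2 + 1 / 2)
      (fun H => shannonEntropy (P H) (X H t)) (Icc 0 1) := fun H hH => by
    simp only
    rw [shannonEntropy_of_map_eq (hne H) (hlaw H hH).2, Real.coe_toNNReal _ (hpos H).le]
  have hboth : ∀ a ∈ Icc (0 : ℝ) 1, DecreasesThenIncreases (expVariance t) a →
      DecreasesThenIncreases (fun H => meanSquare (P H) (X H t)) a ∧
        DecreasesThenIncreases (fun H => shannonEntropy (P H) (X H t)) a := fun a ha h =>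
    ⟨h.congr ha hV, (h.comp strictMonoOn_entropy hpos).congr ha hE⟩
  refine ⟨fun H hH => ⟨memLp_two_of_map_eq (hlaw H hH).1 (hlaw H hH).2,
    hasShannonEntropy_of_map_eq (hlaw H hH).1 (hne H) (hlaw H hH).2⟩,
    ⟨expVarianceSlope t 1, ?_, hs₁⟩, ⟨expVarianceSlope t (1 / 2), ?_, hsh⟩, ?_, ?_, ?_, ?_⟩
  · exact (hasDerivAt_expVariance ht' one_pos).hasDerivWithinAt.congr (fun H hH => (hV hH).symm)
      (hV (right_mem_Icc.2 zero_le_one)).symm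
  · refine (hasDerivAt_expVariance ht' (by norm_num)).congr_of_eventuallyEq ?_
    filter_upwards [Icc_mem_nhds (by norm_num : (0 : ℝ) < 1 / 2)
      (by norm_num : (1 / 2 : ℝ) < 1)] with H hH
    exact (hV hH).symm
  · intro h
    have h1 : expVarianceSlope t 1 ≤ 0 := by
      rw [← sign_nonpos_iff, hs₁, sign_nonpos_iff]
      linarith
    have hanti := strictAntiOn_expVariance ht' h1
    exact ⟨hanti.congr hV, StrictAntiOn.congr (fun x hx y hy hxy =>
      strictMonoOn_entropy (hpos y) (hpos x) (hanti hx hy hxy)) hE⟩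
  · intro h1 h2
    obtain ⟨a, ha, hdec⟩ := exists_decreasesThenIncreases_of_half_neg ht'
      (by rw [← sign_eq_neg_one_iff, hsh, sign_eq_neg_one_iff]; linarith)
      (by rw [← sign_eq_one_iff, hs₁, sign_eq_one_iff]; linarith)
    exact ⟨a, ha, hboth a ⟨by linarith [ha.1], ha.2.le⟩ hdec⟩
  · intro h
    refine hboth _ ⟨by norm_num, by norm_num⟩
      (decreasesThenIncreases_expVariance ht' (by norm_num) (by norm_num) ?_)
    rw [← sign_eq_zero_iff, hsh, h, sub_self, sign_zero]
  · intro h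
    obtain ⟨a, ha, hdec⟩ := exists_decreasesThenIncreases_of_half_pos ht'
      (by rw [← sign_eq_one_iff, hsh, sign_eq_one_iff]; linarith)
    exact ⟨a, ha, hboth a ⟨ha.1.le, by linarith [ha.2]⟩ hdec⟩
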